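/- Let $m$ be a half-integer, $m\in\mathbb Z+\tfrac12$ (or, more generally, any real number that is either a half-integer or satisfies $m\ge\tfrac12$). For real $a,\omega,\mu$ put $\xi=a\omega$, $\nu=a\mu$, and consider the angular eigenvalue problem of the Dirac equation in the Kerr--Newman geometry, for $S=(S^{(+)},S^{(-)})^{T}:(0,\pi)\to\mathbb C^2$, $$\frac{1}{2\sin\theta}\left\{2\begin{pmatrix}0&\sin\theta\\-\sin\theta&0\end{pmatrix}\frac{dS}{d\theta}+\begin{pmatrix}0&\cos\theta\\-\cos\theta&0\end{pmatrix}S+\begin{pmatrix}-2\nu\cos\theta\sin\theta&-2m+2\xi\sin^2\theta\\-2m+2\xi\sin^2\theta&2\nu\cos\theta\sin\theta\end{pmatrix}S\right\}=\lambda S .$$ A number $\lambda\in\mathbb C$ is an eigenvalue, with eigenfunction $S$, if $S$ is a differentiable solution on $(0,\pi)$ that does not vanish identically and whose components are square integrable with respect to $2\sin\theta\,d\theta$. Let $P_n^{(\alpha,\beta)}(x)=\sum_{s=0}^n\binom{n+\alpha}{n-s}\binom{n+\beta}{s}\left(\frac{x-1}2\right)^s\left(\frac{x+1}2\right)^{n-s}$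 denote the Jacobi polynomials. For $a=0$ the following hold. (1) The eigenvalues are exactly the numbers $$\lambda=\pm\left(n+\tfrac12+m\right),\qquad n\in\mathbb N_0,\quad n+2m\ge 0$$ (the condition $n+2m\ge0$ holds for every $n$ if $m>0$). (2) Let $n\in\mathbb N_0$ with $n+2m\ge0$, let $\varepsilon\in\{1,-1\}$ and $\lambda=\varepsilon(n+\tfrac12+m)$. The eigenfunctions for $\lambda$ are exactly the nonzero complex multiples of the function $S$ given on $(0,\pi)$ by $$\sqrt{\sin\theta}\,S(\theta)=\sin^{m+1/2}\theta\begin{pmatrix}\sqrt{\tan\frac\theta2}\;u(\cos\theta)\\ \sqrt{\cot\frac\theta2}\;v(\cos\theta)\end{pmatrix},\qquad u=\varepsilon P_n^{(m+1/2,\,m-1/2)},\quad v=-P_n^{(m-1/2,\,m+1/2)} .$$ (3) With $n,\varepsilon,\lambda$ as in (2) and $v=-P_n^{(m-1/2,m+1/2)}$, every function $u$ satisfying $(1+x)v'(x)=-(m+\tfrac12)v(x)-\lambda u(x)$ on $(-1,1)$ satisfies, for all $x\in(-1,1)$, $$\lambda u(x)=|\lambda|\,P_n^{(m+1/2,m-1/2)}(x),\qquad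 u(x)=\varepsilon P_n^{(m+1/2,m-1/2)}(x)=\pm P_n^{(m+1/2,m-1/2)}(x);$$ that is, $u=\pm P_n^{(\alpha+1,\beta-1)}$ with $\alpha=m-\tfrac12$, $\beta=m+\tfrac12$. -/

import Mathlib

open scoped Matrix

noncomputable section

/-- The Jacobi polynomial `P_n^{(α,β)}`, evaluated at `x`, for arbitrary real parameters:
`∑ s, C(n+α, n-s) C(n+β, s) ((x-1)/2)^s ((x+1)/2)^(n-s)`, with generalized binomial
coefficients `C(r, k) = r (r-1) ⋯ (r-k+1) / k!`. -/
def jacobiP (n : ℕ) (α β x : ℝ) : ℝ :=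
  ∑ s ∈ Finset.range (n + 1),
    Ring.choose ((n : ℝ) + α) (n - s) * Ring.choose ((n : ℝ) + β) s *
      ((x - 1) / 2) ^ s * ((x + 1) / 2) ^ (n - s)

/-- The angular Dirac operator in the Kerr-Newman geometry with rotation parameter `a`, for a
fermion of energy `ω`, mass `μ` and azimuthal number `m`, acting on two-component functions
`S = (S⁺, S⁻)` on `(0, π)`; with `ξ = a ω` and `ν = a μ` it is
`(1 / (2 sin θ)) (2 [0, sin θ; -sin θ, 0] S' + [0, cos θ; -cos θ, 0] S
  + [-2 ν cos θ sin θ, -2 m + 2 ξ sin² θ; -2 m + 2 ξ sin² θ, 2 ν cos θ sin θ] S)`. -/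
def angularOperator (a ω μ m : ℝ) (S : ℝ → Fin 2 → ℂ) (θ : ℝ) : Fin 2 → ℂ :=
  let s : ℂ := (Real.sin θ : ℝ)
  let c : ℂ := (Real.cos θ : ℝ)
  let ξ : ℂ := (a * ω : ℝ)
  let ν : ℂ := (a * μ : ℝ)
  (1 / (2 * s)) •
    ((2 : ℂ) • (!![0, s; -s, 0] *ᵥ deriv S θ) +
      !![0, c; -c, 0] *ᵥ S θ +
      !![-2 * ν * c * s, -2 * (m : ℂ) + 2 * ξ * s ^ 2;
         -2 * (m : ℂ) + 2 * ξ * s ^ 2, 2 * ν * c * s] *ᵥ S θ)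

/-- The measure `2 sin θ dθ` on `(0, π)`. -/
def angularMeasure : MeasureTheory.Measure ℝ :=
  (MeasureTheory.volume.restrict (Set.Ioo 0 Real.pi)).withDensity
    (fun θ => ENNReal.ofReal (2 * Real.sin θ))

/-- `S` is an eigenfunction of the angular operator with eigenvalue `z`: a differentiable solution
on `(0, π)` of the eigenvalue equation, not identically zero, whose components are square
integrable with respect to `2 sin θ dθ`. -/
structure IsAngularEigenfunction (a ω μ m : ℝ) (z : ℂ) (S : ℝ → Fin 2 → ℂ) : Prop where
  differentiableOn : DifferentiableOn ℝ S (Set.Ioo 0 Real.pi)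
  memLp : ∀ i, MeasureTheory.MemLp (fun θ => S θ i) 2 angularMeasure
  eigen : ∀ θ ∈ Set.Ioo 0 Real.pi, angularOperator a ω μ m S θ = z • S θ
  nonzero : ∃ θ ∈ Set.Ioo 0 Real.pi, S θ ≠ 0

/-- `z` is an eigenvalue of the angular operator. -/
def IsAngularEigenvalue (a ω μ m : ℝ) (z : ℂ) : Prop :=
  ∃ S : ℝ → Fin 2 → ℂ, IsAngularEigenfunction a ω μ m z S

/-- The two-component function `S` with
`√(sin θ) S(θ) = (sin θ)^(m+1/2) (√(tan (θ/2)) u(cos θ), √(cot (θ/2)) v(cos θ))`. -/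
def angularSpinor (m : ℝ) (u v : ℝ → ℝ) (θ : ℝ) : Fin 2 → ℂ :=
  ![(((√(Real.sin θ))⁻¹ * (Real.sin θ ^ (m + 1 / 2) *
        (√(Real.tan (θ / 2)) * u (Real.cos θ))) : ℝ) : ℂ),
    (((√(Real.sin θ))⁻¹ * (Real.sin θ ^ (m + 1 / 2) *
        (√(Real.cot (θ / 2)) * v (Real.cos θ))) : ℝ) : ℂ)]

end

/-! For a = 0, the pair (f, g) = √sin · S satisfies f' = -(m/sin) f - z g, g' = (m/sin) g + z f, and
lies in L² of dθ. Two first-order relations between P_n^{(α,β)} and its neighbours with parameters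
shifted by (±1, ∓1) show that the Jacobi functions solve this system at z = ±(n + 1/2 + m).

That nothing else occurs follows from orthogonality plus completeness; no self-adjointness is used.
For solutions (f, g) at z and (p, q) at w, the Wronskian f q - g p has derivative (w - z)(f p + g
q). If (p, q) is a Jacobi solution, it is O(√sin), so square integrability of (f, g) kills the
boundary values, and the pairing ∫ (f p + g q) vanishes when z ≠ w
(`IsReducedSolution.integral_eq_zero`). The pairing is bilinear, so z may be any complex number.

A solution pairing to zero with every Jacobi solution is zero: combining ε = 1 and ε = -1 separates
the components, and Jacobi polynomials span all polynomials, which are dense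
(`IsReducedSolution.eqOn_zero`). Hence every eigenvalue is in the list. At a listed value,
subtracting the projection onto the Jacobi solution leaves zero, so the eigenspace is
one-dimensional.

For m = -(k + 1/2), Jacobi polynomials with negative integer parameters factor, which reduces the
angular functions to those for k + 1/2 with the two components interchanged. -/

/-! ### Generalized binomial coefficients and Jacobi relations -/

theorem ringChoose_succ_mul (r : ℝ) (k : ℕ) :
    ((k : ℝ) + 1) * Ring.choose r (k + 1) = r * Ring.choose (r - 1) k := by
  have h := Ring.choose_smul_choose r (n := k + 1) (k := 1) (by omega)
  simpa [nsmul_eq_mul] using h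

theorem ringChoose_succ_mul' (r : ℝ) (k : ℕ) :
    ((k : ℝ) + 1) * Ring.choose r (k + 1) = Ring.choose r k * (r - k) := by
  have h := Ring.choose_smul_choose r (n := k + 1) (k := k) (by omega)
  simpa [nsmul_eq_mul] using h

theorem ringChoose_pos (r : ℝ) (k : ℕ) (h : (k : ℝ) ≤ r) : 0 < Ring.choose r k := by
  induction k with
  | zero => simp
  | succ k ih =>
    push_cast at h
    have h1 := ih (by linarith)
    have h2 := ringChoose_succ_mul' r k
    have h3 : 0 < Ring.choose r k * (r - k) := mul_pos h1 (by linarith)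
    rw [← h2] at h3
    exact pos_of_mul_pos_right h3 (by positivity)

/-- The coefficients of the Jacobi polynomial in the basis `((x-1)/2)^s ((x+1)/2)^(n-s)`. -/
noncomputable def jacobiCoeff (n : ℕ) (α β : ℝ) (s : ℕ) : ℝ :=
  Ring.choose ((n : ℝ) + α) (n - s) * Ring.choose ((n : ℝ) + β) s

theorem jacobiP_eq_sum (n : ℕ) (α β x : ℝ) : jacobiP n α β x =
    ∑ s ∈ Finset.range (n + 1), jacobiCoeff n α β s * (((x - 1) / 2) ^ s * ((x + 1) / 2) ^ (n - s)) := by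
  simp only [jacobiP, jacobiCoeff, mul_assoc]

theorem jacobiCoeff_pos {n : ℕ} {α β : ℝ} (hα : 0 ≤ α) (hβ : 0 ≤ β) {s : ℕ} (hs : s ≤ n) :
    0 < jacobiCoeff n α β s := by
  refine mul_pos (ringChoose_pos _ _ ?_) (ringChoose_pos _ _ ?_)
  · have : ((n - s : ℕ) : ℝ) ≤ n := by exact_mod_cast Nat.sub_le n s
    linarith
  · have : (s : ℝ) ≤ n := by exact_mod_cast hs
    linarith

/-- The end term s = n of `jacobiCoeff_step`, where there is no next coefficient. The factor is left
as `n - n + β` to match the general summand. -/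
theorem jacobiCoeff_last (n : ℕ) (α β : ℝ) :
    ((n : ℝ) - n + β) * jacobiCoeff n α β n =
      (n + β) * jacobiCoeff n (α + 1) (β - 1) n := by
  have h1 := ringChoose_succ_mul ((n : ℝ) + β) n
  have h2 := ringChoose_succ_mul' ((n : ℝ) + β) n
  simp only [jacobiCoeff, Nat.sub_self, Ring.choose_zero_right, one_mul]
  rw [show (n : ℝ) + (β - 1) = n + β - 1 by ring]
  linear_combination h1 - h2

/-- Coefficient form of the relation `one_add_mul_jacobiDeriv`: Pascal's rule handles the upper
argument containing α, the two absorption identities the one containing β. -/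
theorem jacobiCoeff_step {n s : ℕ} (α β : ℝ) (hs : s < n) :
    ((n : ℝ) - s + β) * jacobiCoeff n α β s + ((s : ℝ) + 1) * jacobiCoeff n α β (s + 1) =
      (n + β) * jacobiCoeff n (α + 1) (β - 1) s := by
  obtain ⟨k, rfl⟩ : ∃ k, n = s + 1 + k := ⟨n - (s + 1), by omega⟩
  have h1 := ringChoose_succ_mul (((s + 1 + k : ℕ) : ℝ) + β) s
  have h2 := ringChoose_succ_mul' (((s + 1 + k : ℕ) : ℝ) + β) s
  have h3 := Ring.choose_succ_succ (((s + 1 + k : ℕ) : ℝ) + α) k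
  simp only [jacobiCoeff]
  rw [show s + 1 + k - s = k + 1 by omega, show s + 1 + k - (s + 1) = k by omega,
    show ((s + 1 + k : ℕ) : ℝ) + (β - 1) = ((s + 1 + k : ℕ) : ℝ) + β - 1 by ring,
    show ((s + 1 + k : ℕ) : ℝ) + (α + 1) = ((s + 1 + k : ℕ) : ℝ) + α + 1 by ring, h3]
  set N : ℝ := ((s + 1 + k : ℕ) : ℝ)
  linear_combination (Ring.choose (N + α) (k + 1)) * (h1 - h2) + (Ring.choose (N + α) k) * h1

/-- The termwise derivative of the Jacobi polynomial. -/
noncomputable def jacobiDeriv (n : ℕ) (α β x : ℝ) : ℝ :=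
  ∑ s ∈ Finset.range (n + 1), jacobiCoeff n α β s *
    (((s : ℝ) * ((x - 1) / 2) ^ (s - 1) * (1 / 2)) * ((x + 1) / 2) ^ (n - s) +
      ((x - 1) / 2) ^ s * (((n - s : ℕ) : ℝ) * ((x + 1) / 2) ^ (n - s - 1) * (1 / 2)))

theorem hasDerivAt_jacobiP (n : ℕ) (α β x : ℝ) :
    HasDerivAt (jacobiP n α β) (jacobiDeriv n α β x) x := by
  have h : jacobiP n α β = fun x => ∑ s ∈ Finset.range (n + 1),
      jacobiCoeff n α β s * (((x - 1) / 2) ^ s * ((x + 1) / 2) ^ (n - s)) :=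
    funext fun x => jacobiP_eq_sum n α β x
  rw [h]
  unfold jacobiDeriv
  refine HasDerivAt.fun_sum fun s _ => HasDerivAt.const_mul _ ?_
  have hA : HasDerivAt (fun x : ℝ => (x - 1) / 2) (1 / 2) x :=
    ((hasDerivAt_id x).sub_const 1).div_const 2
  have hB : HasDerivAt (fun x : ℝ => (x + 1) / 2) (1 / 2) x :=
    ((hasDerivAt_id x).add_const 1).div_const 2
  exact (hA.fun_pow s).fun_mul (hB.fun_pow (n - s))

theorem continuous_jacobiP (n : ℕ) (α β : ℝ) : Continuous (jacobiP n α β) :=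
  continuous_iff_continuousAt.2 fun x => (hasDerivAt_jacobiP n α β x).continuousAt

/-- Multiplying by 1 + x restores the power of (x + 1)/2 lost in differentiation, so both sides
expand in the same products of total degree n. Shifting the index of the terms that lost a factor (x
- 1)/2 leaves a comparison of coefficients. -/
theorem one_add_mul_jacobiDeriv (n : ℕ) (α β x : ℝ) :
    (1 + x) * jacobiDeriv n α β x + β * jacobiP n α β x =
      (n + β) * jacobiP n (α + 1) (β - 1) x := by
  have e1 : (1 + x) * jacobiDeriv n α β x + β * jacobiP n α β x =
      ∑ s ∈ Finset.range (n + 1), ((s : ℝ) * jacobiCoeff n α β s *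
          (((x - 1) / 2) ^ (s - 1) * ((x + 1) / 2) ^ (n - s + 1)) +
        ((n : ℝ) - s + β) * jacobiCoeff n α β s * (((x - 1) / 2) ^ s * ((x + 1) / 2) ^ (n - s))) := by
    rw [jacobiP_eq_sum, jacobiDeriv, Finset.mul_sum, Finset.mul_sum, ← Finset.sum_add_distrib]
    refine Finset.sum_congr rfl fun s hs => ?_
    have hs' : s ≤ n := by simpa [Nat.lt_succ_iff] using hs
    obtain ⟨k, rfl⟩ := Nat.exists_eq_add_of_le hs'
    rw [Nat.add_sub_cancel_left]
    -- For s = n the truncated exponent `n - s - 1` is not one less than `n - s`; the vanishing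
    -- factor `n - s` makes this harmless.
    rcases k with _ | k
    · simp; ring
    · simp only [Nat.add_sub_cancel]; push_cast; ring
  rw [e1, Finset.sum_add_distrib, Finset.sum_range_succ', Finset.sum_range_succ _ n,
    jacobiP_eq_sum, Finset.mul_sum, Finset.sum_range_succ _ n, jacobiCoeff_last n α β]
  simp only [Nat.cast_zero, zero_mul, add_zero]
  rw [← add_assoc, ← Finset.sum_add_distrib]
  congr 1
  · refine Finset.sum_congr rfl fun s hs => ?_
    have hs' : s < n := by simpa using hs
    have h := jacobiCoeff_step α β hs'
    rw [show n - (s + 1) + 1 = n - s by omega, Nat.add_sub_cancel]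
    push_cast
    linear_combination (((x - 1) / 2) ^ s * ((x + 1) / 2) ^ (n - s)) * h
  · ring

theorem jacobiP_neg (n : ℕ) (α β x : ℝ) :
    jacobiP n α β (-x) = (-1) ^ n * jacobiP n β α x := by
  rw [jacobiP_eq_sum, jacobiP_eq_sum, ← Finset.sum_flip, Finset.mul_sum]
  refine Finset.sum_congr rfl fun s hs => ?_
  have hs' : s ≤ n := by simpa [Nat.lt_succ_iff] using hs
  obtain ⟨k, rfl⟩ := Nat.exists_eq_add_of_le hs'
  simp only [jacobiCoeff, Nat.add_sub_cancel_left, Nat.add_sub_cancel]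
  rw [show (-x - 1) / 2 = -1 * ((x + 1) / 2) by ring, show (-x + 1) / 2 = -1 * ((x - 1) / 2) by ring,
    mul_pow, mul_pow, pow_add]
  ring

/-- The mirror image of `one_add_mul_jacobiDeriv` under x ↦ -x, which exchanges α and β. -/
theorem one_sub_mul_jacobiDeriv (n : ℕ) (α β x : ℝ) :
    (1 - x) * jacobiDeriv n α β x - α * jacobiP n α β x =
      -((n + α) * jacobiP n (α - 1) (β + 1) x) := by
  have h := one_add_mul_jacobiDeriv n β α (-x)
  have hd : jacobiDeriv n α β x = (-1) ^ n * (jacobiDeriv n β α (-x) * -1) := by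
    refine (hasDerivAt_jacobiP n α β x).unique ?_
    have h1 := ((hasDerivAt_jacobiP n β α (-x)).comp x (hasDerivAt_neg x)).const_mul ((-1 : ℝ) ^ n)
    refine h1.congr_of_eventuallyEq (Filter.Eventually.of_forall fun y => ?_)
    simp only [Function.comp]
    rw [jacobiP_neg, ← mul_assoc, ← mul_pow]; simp
  have e : (-1 : ℝ) ^ n * (-1) ^ n = 1 := by rw [← mul_pow]; simp
  rw [jacobiP_neg, jacobiP_neg] at h
  rw [hd]
  linear_combination (-(-1 : ℝ) ^ n) * h + (α * jacobiP n α β x - (n + α) * jacobiP n (α - 1) (β + 1) x) * e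

/-- All coefficients become products of ordinary binomials. They vanish for s < k and for s > n + k,
and symmetry of binomials identifies the remaining ones. -/
theorem jacobiP_neg_natCast (n k l : ℕ) (x : ℝ) :
    jacobiP (n + k + l) (-(k : ℝ)) (-(l : ℝ)) x =
      ((x - 1) / 2) ^ k * ((x + 1) / 2) ^ l * jacobiP n k l x := by
  have hc : ∀ s, jacobiCoeff (n + k + l) (-(k : ℝ)) (-(l : ℝ)) s =
      (((n + l).choose (n + k + l - s) * (n + k).choose s : ℕ) : ℝ) := by
    intro s
    rw [jacobiCoeff, show ((n + k + l : ℕ) : ℝ) + -(k : ℝ) = ((n + l : ℕ) : ℝ) by push_cast; ring,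
      show ((n + k + l : ℕ) : ℝ) + -(l : ℝ) = ((n + k : ℕ) : ℝ) by push_cast; ring,
      Ring.choose_natCast, Ring.choose_natCast]
    push_cast; ring
  have hc' : ∀ s, jacobiCoeff n (k : ℝ) (l : ℝ) s =
      (((n + k).choose (n - s) * (n + l).choose s : ℕ) : ℝ) := by
    intro s
    rw [jacobiCoeff, ← Nat.cast_add, ← Nat.cast_add, Ring.choose_natCast, Ring.choose_natCast]
    push_cast; ring
  rw [jacobiP_eq_sum, jacobiP_eq_sum, show n + k + l + 1 = k + (n + 1 + l) by ring,
    Finset.sum_range_add, Finset.sum_range_add, Finset.mul_sum]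
  rw [Finset.sum_eq_zero, zero_add, add_eq_left.2 (Finset.sum_eq_zero _)]
  · refine Finset.sum_congr rfl fun s hs => ?_
    have hs' : s ≤ n := by simpa [Nat.lt_succ_iff] using hs
    obtain ⟨t, rfl⟩ := Nat.exists_eq_add_of_le hs'
    rw [hc, hc', show s + t + k + l - (k + s) = t + l by omega, Nat.add_sub_cancel_left,
      show (s + t + l).choose (t + l) = (s + t + l).choose s from
        Nat.choose_symm_of_eq_add (by ring),
      show (s + t + k).choose (k + s) = (s + t + k).choose t from
        Nat.choose_symm_of_eq_add (by ring)]
    push_cast; ring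
  · intro s _
    rw [hc, Nat.choose_eq_zero_of_lt (show n + k < k + (n + 1 + s) by omega)]; simp
  · intro s hs
    have hs' : s < k := by simpa using hs
    rw [hc, Nat.choose_eq_zero_of_lt (show n + l < n + k + l - s by omega)]; simp

/-! ### Completeness of Jacobi polynomials -/

open Polynomial in
/-- The Jacobi polynomial as an element of `ℝ[X]`. -/
noncomputable def jacobiPoly (n : ℕ) (α β : ℝ) : ℝ[X] :=
  ∑ s ∈ Finset.range (n + 1), C (jacobiCoeff n α β s * (1 / 2) ^ n) *
    ((X - C 1) ^ s * (X + C 1) ^ (n - s))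

theorem eval_jacobiPoly (n : ℕ) (α β x : ℝ) : (jacobiPoly n α β).eval x = jacobiP n α β x := by
  rw [jacobiP_eq_sum, jacobiPoly, Polynomial.eval_finsetSum]
  refine Finset.sum_congr rfl fun s hs => ?_
  have hs' : s ≤ n := by simpa [Nat.lt_succ_iff] using hs
  obtain ⟨k, rfl⟩ := Nat.exists_eq_add_of_le hs'
  simp only [Polynomial.eval_mul, Polynomial.eval_C, Polynomial.eval_pow, Polynomial.eval_sub,
    Polynomial.eval_add, Polynomial.eval_X, Nat.add_sub_cancel_left, div_pow, pow_add]
  ring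

open Polynomial in
-- Each basis product is monic of degree n, so the leading coefficient is a sum of positive numbers
-- and cannot cancel.
theorem degree_jacobiPoly (n : ℕ) {α β : ℝ} (hα : 0 ≤ α) (hβ : 0 ≤ β) :
    (jacobiPoly n α β).degree = n := by
  have hm : ∀ s ≤ n, ((X - C (1 : ℝ)) ^ s * (X + C 1) ^ (n - s)).Monic ∧
      ((X - C (1 : ℝ)) ^ s * (X + C 1) ^ (n - s)).natDegree = n := by
    intro s hs
    have h1 := (monic_X_sub_C (1 : ℝ)).pow s
    have h2 := (monic_X_add_C (1 : ℝ)).pow (n - s)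
    refine ⟨h1.mul h2, ?_⟩
    rw [h1.natDegree_mul h2, (monic_X_sub_C (1 : ℝ)).natDegree_pow,
      (monic_X_add_C (1 : ℝ)).natDegree_pow, natDegree_X_sub_C, natDegree_X_add_C]
    omega
  refine degree_eq_of_le_of_coeff_ne_zero ?_ ?_
  · refine (degree_sum_le _ _).trans (Finset.sup_le fun s hs => ?_)
    have hs' : s ≤ n := by simpa [Nat.lt_succ_iff] using hs
    exact degree_le_of_natDegree_le ((natDegree_C_mul_le _ _).trans (hm s hs').2.le)
  · rw [jacobiPoly, finsetSum_coeff]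
    refine (Finset.sum_pos (fun s hs => ?_) ⟨0, by simp⟩).ne'
    have hs' : s ≤ n := by simpa [Nat.lt_succ_iff] using hs
    obtain ⟨h1, h2⟩ := hm s hs'
    have h3 : ((X - C (1 : ℝ)) ^ s * (X + C 1) ^ (n - s)).coeff n = 1 := by
      have := h1.coeff_natDegree
      rwa [h2] at this
    rw [coeff_C_mul, h3, mul_one]
    exact mul_pos (jacobiCoeff_pos hα hβ hs') (by positivity)

open Polynomial in
theorem span_jacobiPoly {α β : ℝ} (hα : 0 ≤ α) (hβ : 0 ≤ β) :
    Submodule.span ℝ (Set.range fun n => jacobiPoly n α β) = ⊤ := by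
  let S : Polynomial.Sequence ℝ :=
    { elems' := fun n => jacobiPoly n α β
      degree_eq' := fun n => degree_jacobiPoly n hα hβ }
  exact S.span fun n => (leadingCoeff_ne_zero.2 (S.ne_zero n)).isUnit

open MeasureTheory Set in
theorem integrableOn_continuous_smul {k : ℝ → ℂ} (hk : IntegrableOn k (Ioo 0 Real.pi))
    {φ : ℝ → ℝ} (hφ : Continuous φ) : IntegrableOn (fun θ => φ θ • k θ) (Ioo 0 Real.pi) := by
  obtain ⟨C, hC⟩ := (isCompact_Icc (a := (0 : ℝ)) (b := Real.pi)).exists_bound_of_continuousOn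
    hφ.continuousOn
  refine Integrable.bdd_smul hk C hφ.aestronglyMeasurable ?_
  filter_upwards [ae_restrict_mem measurableSet_Ioo] with θ hθ
  exact hC θ (Ioo_subset_Icc_self hθ)

open MeasureTheory Set in
theorem integral_eval_cos_smul_eq_zero {α β : ℝ} (hα : 0 ≤ α) (hβ : 0 ≤ β) {k : ℝ → ℂ}
    (hk : IntegrableOn k (Ioo 0 Real.pi))
    (h : ∀ n, ∫ θ in Ioo 0 Real.pi, jacobiP n α β (Real.cos θ) • k θ = 0) (p : Polynomial ℝ) :
    ∫ θ in Ioo 0 Real.pi, p.eval (Real.cos θ) • k θ = 0 := by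
  have hp : p ∈ Submodule.span ℝ (Set.range fun n => jacobiPoly n α β) := by
    rw [span_jacobiPoly hα hβ]; trivial
  induction hp using Submodule.span_induction with
  | mem x hx =>
    obtain ⟨n, rfl⟩ := hx
    simpa only [eval_jacobiPoly] using h n
  | zero => simp
  | add x y _ _ hx hy =>
    simp only [Polynomial.eval_add, add_smul]
    rw [integral_add (integrableOn_continuous_smul hk (by fun_prop))
      (integrableOn_continuous_smul hk (by fun_prop)), hx, hy, add_zero]
  | smul a x _ hx =>
    simp only [Polynomial.eval_smul, smul_assoc]
    rw [integral_smul, hx, smul_zero]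

open MeasureTheory Set in
theorem integral_continuous_smul_eq_zero {k : ℝ → ℂ} (hk : IntegrableOn k (Ioo 0 Real.pi))
    (h : ∀ p : Polynomial ℝ, ∫ θ in Ioo 0 Real.pi, p.eval (Real.cos θ) • k θ = 0)
    {φ : ℝ → ℝ} (hφ : Continuous φ) : ∫ θ in Ioo 0 Real.pi, φ θ • k θ = 0 := by
  set K : ℝ := ∫ θ in Ioo 0 Real.pi, ‖k θ‖ with hK
  have hK0 : 0 ≤ K := integral_nonneg fun _ => norm_nonneg _
  have key : ∀ ε : ℝ, 0 < ε → ‖∫ θ in Ioo 0 Real.pi, φ θ • k θ‖ ≤ ε * K := by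
    intro ε hε
    -- Weierstrass approximation in the variable x = cos θ; on (0, π), arccos inverts cos.
    obtain ⟨p, hp⟩ := exists_polynomial_near_of_continuousOn (-1) 1 (fun x => φ (Real.arccos x))
      (hφ.comp Real.continuous_arccos).continuousOn ε hε
    have e : ∫ θ in Ioo 0 Real.pi, φ θ • k θ =
        ∫ θ in Ioo 0 Real.pi, (φ θ - p.eval (Real.cos θ)) • k θ := by
      simp only [sub_smul]
      rw [integral_sub (integrableOn_continuous_smul hk hφ)
        (integrableOn_continuous_smul hk (by fun_prop)), h p, sub_zero]
    rw [e, hK, ← integral_const_mul]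
    refine norm_integral_le_of_norm_le (hk.norm.const_mul ε) ?_
    filter_upwards [ae_restrict_mem measurableSet_Ioo] with θ hθ
    rw [norm_smul]
    gcongr
    have := hp (Real.cos θ) ⟨Real.neg_one_le_cos θ, Real.cos_le_one θ⟩
    rw [Real.arccos_cos hθ.1.le hθ.2.le, abs_sub_comm] at this
    exact this.le
  rw [← norm_le_zero_iff]
  refine le_of_forall_pos_le_add fun δ hδ => ?_
  refine (key (δ / (K + 1)) (by positivity)).trans ?_
  rw [zero_add, div_mul_eq_mul_div, div_le_iff₀ (by positivity)]
  nlinarith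

open MeasureTheory Set in
theorem eqOn_zero_of_forall_integral_jacobiP {α β : ℝ} (hα : 0 ≤ α) (hβ : 0 ≤ β) {k : ℝ → ℂ}
    (hk : IntegrableOn k (Ioo 0 Real.pi)) (hc : ContinuousOn k (Ioo 0 Real.pi))
    (h : ∀ n, ∫ θ in Ioo 0 Real.pi, jacobiP n α β (Real.cos θ) • k θ = 0) :
    EqOn k 0 (Ioo 0 Real.pi) := by
  have h0 := integral_eval_cos_smul_eq_zero hα hβ hk h
  have h1 : ∀ᵐ θ ∂(volume : Measure ℝ), θ ∈ Ioo 0 Real.pi → k θ = 0 := by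
    refine isOpen_Ioo.ae_eq_zero_of_integral_contDiff_smul_eq_zero hk.locallyIntegrableOn ?_
    intro g hg _ hs
    rw [← integral_continuous_smul_eq_zero hk h0 hg.continuous]
    refine (setIntegral_eq_integral_of_forall_compl_eq_zero fun θ hθ => ?_).symm
    rw [image_eq_zero_of_notMem_tsupport (fun h => hθ (hs h)), zero_smul]
  refine Measure.eqOn_open_of_ae_eq (μ := volume) ?_ isOpen_Ioo hc continuousOn_const
  exact (ae_restrict_iff' measurableSet_Ioo).2 h1

/-! ### Angular functions and their differential equations -/

/-- The first angular function `sin^m θ √(1 - cos θ) P_n^{(m+1/2, m-1/2)}(cos θ)`. -/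
noncomputable def angularFst (m : ℝ) (n : ℕ) (θ : ℝ) : ℝ :=
  Real.sin θ ^ m * √(1 - Real.cos θ) * jacobiP n (m + 1 / 2) (m - 1 / 2) (Real.cos θ)

/-- The second angular function `sin^m θ √(1 + cos θ) P_n^{(m-1/2, m+1/2)}(cos θ)`. -/
noncomputable def angularSnd (m : ℝ) (n : ℕ) (θ : ℝ) : ℝ :=
  Real.sin θ ^ m * √(1 + Real.cos θ) * jacobiP n (m - 1 / 2) (m + 1 / 2) (Real.cos θ)

theorem cos_mem_Ioo {θ : ℝ} (hθ : θ ∈ Set.Ioo 0 Real.pi) : Real.cos θ ∈ Set.Ioo (-1 : ℝ) 1 := by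
  have h := Real.sin_pos_of_mem_Ioo hθ
  have := Real.sin_sq_add_cos_sq θ
  constructor <;> nlinarith

theorem sqrt_mul_sqrt_cos {θ : ℝ} (hθ : θ ∈ Set.Ioo 0 Real.pi) :
    √(1 - Real.cos θ) * √(1 + Real.cos θ) = Real.sin θ := by
  have h := cos_mem_Ioo hθ
  rw [← Real.sqrt_mul (by linarith [h.2]), Real.sqrt_eq_iff_mul_self_eq_of_pos
    (Real.sin_pos_of_mem_Ioo hθ)]
  linarith [Real.sin_sq_add_cos_sq θ]

theorem hasDerivAt_sqrt_one_sub_cos {θ : ℝ} (hθ : θ ∈ Set.Ioo 0 Real.pi) :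
    HasDerivAt (fun θ => √(1 - Real.cos θ)) (√(1 + Real.cos θ) / 2) θ := by
  have h := cos_mem_Ioo hθ
  have hp : 0 < √(1 - Real.cos θ) := Real.sqrt_pos.2 (by linarith [h.2])
  convert ((Real.hasDerivAt_cos θ).const_sub 1).sqrt (by linarith [h.2]) using 1
  rw [← sqrt_mul_sqrt_cos hθ]
  field_simp

theorem hasDerivAt_sqrt_one_add_cos {θ : ℝ} (hθ : θ ∈ Set.Ioo 0 Real.pi) :
    HasDerivAt (fun θ => √(1 + Real.cos θ)) (-(√(1 - Real.cos θ) / 2)) θ := by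
  have h := cos_mem_Ioo hθ
  have hp : 0 < √(1 + Real.cos θ) := Real.sqrt_pos.2 (by linarith [h.1])
  convert ((Real.hasDerivAt_cos θ).const_add 1).sqrt (by linarith [h.1]) using 1
  rw [← sqrt_mul_sqrt_cos hθ]
  field_simp

theorem hasDerivAt_sin_rpow (m : ℝ) {θ : ℝ} (hθ : θ ∈ Set.Ioo 0 Real.pi) :
    HasDerivAt (fun θ => Real.sin θ ^ m) (Real.sin θ ^ m * (m * Real.cos θ / Real.sin θ)) θ := by
  have hs := Real.sin_pos_of_mem_Ioo hθ
  convert (Real.hasDerivAt_sin θ).rpow_const (p := m) (Or.inl hs.ne') using 1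
  rw [Real.rpow_sub_one hs.ne']
  ring

/-- The weight is chosen so that its derivative combines with that of the polynomial into the left
side of `one_sub_mul_jacobiDeriv`. -/
theorem hasDerivAt_angularFst (m : ℝ) (n : ℕ) {θ : ℝ} (hθ : θ ∈ Set.Ioo 0 Real.pi) :
    HasDerivAt (angularFst m n)
      (-(m / Real.sin θ) * angularFst m n θ + (n + 1 / 2 + m) * angularSnd m n θ) θ := by
  have hs := Real.sin_pos_of_mem_Ioo hθ
  have h := cos_mem_Ioo hθ
  have hd := ((hasDerivAt_sin_rpow m hθ).mul (hasDerivAt_sqrt_one_sub_cos hθ)).mul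
    ((hasDerivAt_jacobiP n (m + 1 / 2) (m - 1 / 2) (Real.cos θ)).comp θ (Real.hasDerivAt_cos θ))
  refine hd.congr_deriv ?_
  have hJ := one_sub_mul_jacobiDeriv n (m + 1 / 2) (m - 1 / 2) (Real.cos θ)
  rw [show m + 1 / 2 - 1 = m - 1 / 2 by ring, show m - 1 / 2 + 1 = m + 1 / 2 by ring] at hJ
  have hpq := sqrt_mul_sqrt_cos hθ
  have hp2 := Real.sq_sqrt (show 0 ≤ 1 - Real.cos θ by linarith [h.2])
  have hq2 := Real.sq_sqrt (show 0 ≤ 1 + Real.cos θ by linarith [h.1])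
  have hs2 := Real.sin_sq_add_cos_sq θ
  simp only [Function.comp, Pi.mul_apply, angularFst, angularSnd]
  clear hd
  -- With these quantities as free variables, the claim is algebra modulo p q = s, p² = 1 - c, q² =
  -- 1 + c, s² + c² = 1 and the Jacobi relation.
  generalize √(1 - Real.cos θ) = p at *
  generalize √(1 + Real.cos θ) = q at *
  generalize Real.sin θ ^ m = r at *
  generalize jacobiP n (m + 1 / 2) (m - 1 / 2) (Real.cos θ) = P at *
  generalize jacobiP n (m - 1 / 2) (m + 1 / 2) (Real.cos θ) = Q at *
  generalize jacobiDeriv n (m + 1 / 2) (m - 1 / 2) (Real.cos θ) = D at *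
  generalize Real.cos θ = c at *
  generalize Real.sin θ = s at *
  field_simp
  linear_combination r * (-2 * p * (1 + c) * hJ +
    (P - (2 * n + 1 + 2 * m) * Q) * (p * hq2 - q * hpq) - 2 * p * D * hs2)

theorem hasDerivAt_angularSnd (m : ℝ) (n : ℕ) {θ : ℝ} (hθ : θ ∈ Set.Ioo 0 Real.pi) :
    HasDerivAt (angularSnd m n)
      (m / Real.sin θ * angularSnd m n θ - (n + 1 / 2 + m) * angularFst m n θ) θ := by
  have hs := Real.sin_pos_of_mem_Ioo hθ
  have h := cos_mem_Ioo hθ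
  have hd := ((hasDerivAt_sin_rpow m hθ).mul (hasDerivAt_sqrt_one_add_cos hθ)).mul
    ((hasDerivAt_jacobiP n (m - 1 / 2) (m + 1 / 2) (Real.cos θ)).comp θ (Real.hasDerivAt_cos θ))
  refine hd.congr_deriv ?_
  have hJ := one_add_mul_jacobiDeriv n (m - 1 / 2) (m + 1 / 2) (Real.cos θ)
  rw [show m + 1 / 2 - 1 = m - 1 / 2 by ring, show m - 1 / 2 + 1 = m + 1 / 2 by ring] at hJ
  have hpq := sqrt_mul_sqrt_cos hθ
  have hp2 := Real.sq_sqrt (show 0 ≤ 1 - Real.cos θ by linarith [h.2])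
  have hq2 := Real.sq_sqrt (show 0 ≤ 1 + Real.cos θ by linarith [h.1])
  have hs2 := Real.sin_sq_add_cos_sq θ
  simp only [Function.comp, Pi.mul_apply, angularFst, angularSnd]
  clear hd
  generalize √(1 - Real.cos θ) = p at *
  generalize √(1 + Real.cos θ) = q at *
  generalize Real.sin θ ^ m = r at *
  generalize jacobiP n (m + 1 / 2) (m - 1 / 2) (Real.cos θ) = P at *
  generalize jacobiP n (m - 1 / 2) (m + 1 / 2) (Real.cos θ) = Q at *
  generalize jacobiDeriv n (m - 1 / 2) (m + 1 / 2) (Real.cos θ) = D at *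
  generalize Real.cos θ = c at *
  generalize Real.sin θ = s at *
  field_simp
  linear_combination r * (-2 * q * (1 - c) * hJ -
    (Q - (2 * n + 1 + 2 * m) * P) * (q * hp2 - p * hpq) - 2 * q * D * hs2)

theorem sin_rpow_natCast_add_half (k : ℕ) {θ : ℝ} (hθ : θ ∈ Set.Ioo 0 Real.pi) :
    Real.sin θ ^ ((k : ℝ) + 1 / 2) = Real.sin θ ^ (-((k : ℝ) + 1 / 2)) *
      (Real.sin θ * ((1 - Real.cos θ) * (1 + Real.cos θ)) ^ k) := by
  have hs := Real.sin_pos_of_mem_Ioo hθ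
  rw [show (1 - Real.cos θ) * (1 + Real.cos θ) = Real.sin θ ^ 2 by
    linarith [Real.sin_sq_add_cos_sq θ], ← pow_mul, ← pow_succ', ← Real.rpow_natCast,
    ← Real.rpow_add hs]
  congr 1; push_cast; ring

/-- The powers of 1 ± cos split off by `jacobiP_neg_natCast` compensate the singular weight
sin^(-(k+1/2)) and turn the first component into the second one for k + 1/2. -/
theorem angularFst_neg (n k : ℕ) {θ : ℝ} (hθ : θ ∈ Set.Ioo 0 Real.pi) :
    angularFst (-((k : ℝ) + 1 / 2)) (n + (2 * k + 1)) θ =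
      (-1) ^ k * (1 / 2) ^ (2 * k + 1) * angularSnd (k + 1 / 2) n θ := by
  have h := cos_mem_Ioo hθ
  have hpq := sqrt_mul_sqrt_cos hθ
  have hq2 := Real.sq_sqrt (show 0 ≤ 1 + Real.cos θ by linarith [h.1])
  have hJ := jacobiP_neg_natCast n k (k + 1) (Real.cos θ)
  rw [show n + k + (k + 1) = n + (2 * k + 1) by ring] at hJ
  push_cast at hJ
  simp only [angularFst, angularSnd]
  rw [show -((k : ℝ) + 1 / 2) + 1 / 2 = -k by ring,
    show -((k : ℝ) + 1 / 2) - 1 / 2 = -(k + 1) by ring, hJ, sin_rpow_natCast_add_half k hθ,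
    show (k : ℝ) + 1 / 2 - 1 / 2 = k by ring, show (k : ℝ) + 1 / 2 + 1 / 2 = k + 1 by ring,
    show (Real.cos θ - 1) / 2 = -1 * ((1 - Real.cos θ) * (1 / 2)) by ring,
    show (Real.cos θ + 1) / 2 = (1 + Real.cos θ) * (1 / 2) by ring]
  generalize √(1 - Real.cos θ) = p at *
  generalize √(1 + Real.cos θ) = q at *
  generalize Real.sin θ ^ (-((k : ℝ) + 1 / 2)) = r
  generalize jacobiP n k (k + 1) (Real.cos θ) = P
  generalize 1 - Real.cos θ = A at *
  generalize 1 + Real.cos θ = B at *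
  generalize (1 / 2 : ℝ) = d
  generalize (-1 : ℝ) = e
  simp only [← hpq, ← hq2]
  ring

theorem angularSnd_neg (n k : ℕ) {θ : ℝ} (hθ : θ ∈ Set.Ioo 0 Real.pi) :
    angularSnd (-((k : ℝ) + 1 / 2)) (n + (2 * k + 1)) θ =
      (-1) ^ (k + 1) * (1 / 2) ^ (2 * k + 1) * angularFst (k + 1 / 2) n θ := by
  have h := cos_mem_Ioo hθ
  have hpq := sqrt_mul_sqrt_cos hθ
  have hp2 := Real.sq_sqrt (show 0 ≤ 1 - Real.cos θ by linarith [h.2])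
  have hJ := jacobiP_neg_natCast n (k + 1) k (Real.cos θ)
  rw [show n + (k + 1) + k = n + (2 * k + 1) by ring] at hJ
  push_cast at hJ
  simp only [angularFst, angularSnd]
  rw [show -((k : ℝ) + 1 / 2) + 1 / 2 = -k by ring,
    show -((k : ℝ) + 1 / 2) - 1 / 2 = -(k + 1) by ring, hJ, sin_rpow_natCast_add_half k hθ,
    show (k : ℝ) + 1 / 2 - 1 / 2 = k by ring, show (k : ℝ) + 1 / 2 + 1 / 2 = k + 1 by ring,
    show (Real.cos θ - 1) / 2 = -1 * ((1 - Real.cos θ) * (1 / 2)) by ring,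
    show (Real.cos θ + 1) / 2 = (1 + Real.cos θ) * (1 / 2) by ring]
  generalize √(1 - Real.cos θ) = p at *
  generalize √(1 + Real.cos θ) = q at *
  generalize Real.sin θ ^ (-((k : ℝ) + 1 / 2)) = r
  generalize jacobiP n (k + 1) k (Real.cos θ) = P
  generalize 1 - Real.cos θ = A at *
  generalize 1 + Real.cos θ = B at *
  generalize (1 / 2 : ℝ) = d
  generalize (-1 : ℝ) = e
  simp only [← hpq, ← hp2]
  ring

/-! ### Decay, completeness and nonvanishing of the angular functions -/

theorem half_le_or_exists_eq_neg {m : ℝ} (hm : 1 / 2 ≤ m ∨ ∃ k : ℤ, m = (k : ℝ) + 1 / 2) :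
    1 / 2 ≤ m ∨ ∃ k : ℕ, m = -((k : ℝ) + 1 / 2) := by
  rcases hm with h | ⟨k, rfl⟩
  · exact Or.inl h
  · rcases le_or_gt 0 k with hk | hk
    · left
      have : (0 : ℝ) ≤ k := by exact_mod_cast hk
      linarith
    · right
      obtain ⟨l, hl⟩ := Int.eq_ofNat_of_zero_le (show 0 ≤ -k - 1 by omega)
      refine ⟨l, ?_⟩
      have : ((-k - 1 : ℤ) : ℝ) = l := by rw [hl]; simp
      push_cast at this
      linarith

theorem exists_add_of_nonneg_add {n k : ℕ} (h : 0 ≤ (n : ℝ) + 2 * -((k : ℝ) + 1 / 2)) :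
    ∃ j, n = j + (2 * k + 1) := by
  have : 2 * k + 1 ≤ n := by
    have : ((2 * k + 1 : ℕ) : ℝ) ≤ n := by push_cast; linarith
    exact_mod_cast this
  exact ⟨n - (2 * k + 1), by omega⟩

/-- Since 0 < sin ≤ 1 and m ≥ 1/2, sin^m ≤ √sin; the other factors are continuous on [0, π]. This
decay is what removes the boundary terms of the Wronskian. -/
theorem angular_bound_of_half_le {m : ℝ} (hm : 1 / 2 ≤ m) (n : ℕ) :
    ∃ C : ℝ, 0 ≤ C ∧ ∀ θ ∈ Set.Ioo 0 Real.pi,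
      |angularFst m n θ| ≤ C * √(Real.sin θ) ∧ |angularSnd m n θ| ≤ C * √(Real.sin θ) := by
  obtain ⟨C, hC⟩ := (isCompact_Icc (a := (0 : ℝ)) (b := Real.pi)).exists_bound_of_continuousOn
    (f := fun θ => (√(1 - Real.cos θ) * jacobiP n (m + 1 / 2) (m - 1 / 2) (Real.cos θ),
      √(1 + Real.cos θ) * jacobiP n (m - 1 / 2) (m + 1 / 2) (Real.cos θ)))
    (by
      have h1 := continuous_jacobiP n (m + 1 / 2) (m - 1 / 2)
      have h2 := continuous_jacobiP n (m - 1 / 2) (m + 1 / 2)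
      fun_prop)
  refine ⟨C, (norm_nonneg _).trans (hC 0 ⟨le_rfl, Real.pi_pos.le⟩), fun θ hθ => ?_⟩
  have hs := Real.sin_pos_of_mem_Ioo hθ
  have hr : Real.sin θ ^ m ≤ √(Real.sin θ) := by
    rw [Real.sqrt_eq_rpow]
    exact Real.rpow_le_rpow_of_exponent_ge hs (Real.sin_le_one θ) hm
  have hr0 : 0 ≤ Real.sin θ ^ m := Real.rpow_nonneg hs.le m
  have hb := hC θ (Set.Ioo_subset_Icc_self hθ)
  rw [Prod.norm_def, max_le_iff] at hb
  simp only [Real.norm_eq_abs] at hb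
  simp only [angularFst, angularSnd, mul_assoc, abs_mul (Real.sin θ ^ m), abs_of_nonneg hr0]
  rw [mul_comm C]
  exact ⟨mul_le_mul hr hb.1 (abs_nonneg _) (Real.sqrt_nonneg _),
    mul_le_mul hr hb.2 (abs_nonneg _) (Real.sqrt_nonneg _)⟩

theorem angular_bound {m : ℝ} (hm : 1 / 2 ≤ m ∨ ∃ k : ℤ, m = (k : ℝ) + 1 / 2) {n : ℕ}
    (hn : 0 ≤ (n : ℝ) + 2 * m) :
    ∃ C : ℝ, 0 ≤ C ∧ ∀ θ ∈ Set.Ioo 0 Real.pi,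
      |angularFst m n θ| ≤ C * √(Real.sin θ) ∧ |angularSnd m n θ| ≤ C * √(Real.sin θ) := by
  rcases half_le_or_exists_eq_neg hm with h | ⟨k, rfl⟩
  · exact angular_bound_of_half_le h n
  · obtain ⟨j, rfl⟩ := exists_add_of_nonneg_add hn
    obtain ⟨C, hC0, hC⟩ := angular_bound_of_half_le (m := k + 1 / 2)
      (by linarith [Nat.cast_nonneg (α := ℝ) k]) j
    refine ⟨(1 / 2) ^ (2 * k + 1) * C, by positivity, fun θ hθ => ?_⟩
    rw [angularFst_neg j k hθ, angularSnd_neg j k hθ]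
    simp only [abs_mul, abs_pow, abs_neg, abs_one, one_pow, one_mul, mul_assoc]
    rw [abs_of_pos (show (0 : ℝ) < 1 / 2 by norm_num)]
    exact ⟨mul_le_mul_of_nonneg_left (hC θ hθ).2 (by positivity),
      mul_le_mul_of_nonneg_left (hC θ hθ).1 (by positivity)⟩

open MeasureTheory Set in
-- The weight is absorbed into f, leaving vanishing Jacobi moments with nonnegative parameters; the
-- weight is positive inside (0, π) and can then be divided out.
theorem angular_complete_of_half_le {m : ℝ} (hm : 1 / 2 ≤ m) {f : ℝ → ℂ}
    (hf : IntegrableOn f (Ioo 0 Real.pi)) (hc : ContinuousOn f (Ioo 0 Real.pi)) :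
    ((∀ n, ∫ θ in Ioo 0 Real.pi, angularFst m n θ • f θ = 0) → EqOn f 0 (Ioo 0 Real.pi)) ∧
    ((∀ n, ∫ θ in Ioo 0 Real.pi, angularSnd m n θ • f θ = 0) → EqOn f 0 (Ioo 0 Real.pi)) := by
  have hr : Continuous fun θ => Real.sin θ ^ m :=
    Real.continuous_sin.rpow_const fun _ => Or.inr (by linarith)
  constructor
  all_goals intro h
  · have hw : Continuous fun θ => Real.sin θ ^ m * √(1 - Real.cos θ) := by fun_prop
    have h0 := eqOn_zero_of_forall_integral_jacobiP (α := m + 1 / 2) (β := m - 1 / 2)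
      (by linarith) (by linarith) (integrableOn_continuous_smul hf hw) (hw.continuousOn.smul hc)
      (fun n => by
        rw [← h n]
        refine integral_congr_ae (Filter.Eventually.of_forall fun θ => ?_)
        simp only [angularFst, smul_smul]
        congr 1; ring)
    intro θ hθ
    have hs := Real.rpow_pos_of_pos (Real.sin_pos_of_mem_Ioo hθ) m
    have hp : 0 < √(1 - Real.cos θ) := Real.sqrt_pos.2 (by linarith [(cos_mem_Ioo hθ).2])
    exact (smul_eq_zero.1 (h0 hθ)).resolve_left (mul_pos hs hp).ne'
  · have hw : Continuous fun θ => Real.sin θ ^ m * √(1 + Real.cos θ) := by fun_prop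
    have h0 := eqOn_zero_of_forall_integral_jacobiP (α := m - 1 / 2) (β := m + 1 / 2)
      (by linarith) (by linarith) (integrableOn_continuous_smul hf hw) (hw.continuousOn.smul hc)
      (fun n => by
        rw [← h n]
        refine integral_congr_ae (Filter.Eventually.of_forall fun θ => ?_)
        simp only [angularSnd, smul_smul]
        congr 1; ring)
    intro θ hθ
    have hs := Real.rpow_pos_of_pos (Real.sin_pos_of_mem_Ioo hθ) m
    have hp : 0 < √(1 + Real.cos θ) := Real.sqrt_pos.2 (by linarith [(cos_mem_Ioo hθ).1])
    exact (smul_eq_zero.1 (h0 hθ)).resolve_left (mul_pos hs hp).ne'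

open MeasureTheory Set in
theorem angular_complete {m : ℝ} (hm : 1 / 2 ≤ m ∨ ∃ k : ℤ, m = (k : ℝ) + 1 / 2) {f : ℝ → ℂ}
    (hf : IntegrableOn f (Ioo 0 Real.pi)) (hc : ContinuousOn f (Ioo 0 Real.pi)) :
    ((∀ n : ℕ, 0 ≤ (n : ℝ) + 2 * m → ∫ θ in Ioo 0 Real.pi, angularFst m n θ • f θ = 0) →
      EqOn f 0 (Ioo 0 Real.pi)) ∧
    ((∀ n : ℕ, 0 ≤ (n : ℝ) + 2 * m → ∫ θ in Ioo 0 Real.pi, angularSnd m n θ • f θ = 0) →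
      EqOn f 0 (Ioo 0 Real.pi)) := by
  rcases half_le_or_exists_eq_neg hm with h | ⟨k, rfl⟩
  · have hn : ∀ n : ℕ, 0 ≤ (n : ℝ) + 2 * m := fun n => by positivity
    have hC := angular_complete_of_half_le h hf hc
    exact ⟨fun h0 => hC.1 fun n => h0 n (hn n), fun h0 => hC.2 fun n => h0 n (hn n)⟩
  · have hC := angular_complete_of_half_le (m := k + 1 / 2)
      (by linarith [Nat.cast_nonneg (α := ℝ) k]) hf hc
    have hn : ∀ n : ℕ, 0 ≤ ((n + (2 * k + 1) : ℕ) : ℝ) + 2 * -((k : ℝ) + 1 / 2) := fun n => by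
      push_cast; linarith [Nat.cast_nonneg (α := ℝ) n]
    have hd : ∀ j : ℕ, ((-1 : ℝ) ^ j * (1 / 2) ^ (2 * k + 1)) ≠ 0 := fun j => by positivity
    -- The components are interchanged, and the admissible indices are exactly the shifts n + (2k +
    -- 1).
    refine ⟨fun h0 => hC.2 fun n => ?_, fun h0 => hC.1 fun n => ?_⟩
    · have h1 := h0 _ (hn n)
      rw [setIntegral_congr_fun measurableSet_Ioo
        (fun θ hθ => by
          show _ = ((-1 : ℝ) ^ k * (1 / 2) ^ (2 * k + 1)) • (angularSnd (k + 1 / 2) n θ • f θ)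
          rw [angularFst_neg n k hθ, smul_smul]), integral_smul] at h1
      exact (smul_eq_zero.1 h1).resolve_left (hd k)
    · have h1 := h0 _ (hn n)
      rw [setIntegral_congr_fun measurableSet_Ioo
        (fun θ hθ => by
          show _ = ((-1 : ℝ) ^ (k + 1) * (1 / 2) ^ (2 * k + 1)) •
            (angularFst (k + 1 / 2) n θ • f θ)
          rw [angularSnd_neg n k hθ, smul_smul]), integral_smul] at h1
      exact (smul_eq_zero.1 h1).resolve_left (hd (k + 1))

theorem angular_ne_zero_of_half_le {m : ℝ} (hm : 1 / 2 ≤ m) (n : ℕ) :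
    (∃ θ ∈ Set.Ioo 0 Real.pi, angularFst m n θ ≠ 0) ∧
      ∃ θ ∈ Set.Ioo 0 Real.pi, angularSnd m n θ ≠ 0 := by
  have key : ∀ α β : ℝ, 0 ≤ α → 0 ≤ β → ∃ θ ∈ Set.Ioo 0 Real.pi,
      jacobiP n α β (Real.cos θ) ≠ 0 := by
    intro α β hα hβ
    have hne : jacobiPoly n α β ≠ 0 := fun h => by
      have := degree_jacobiPoly n hα hβ
      simp [h] at this
    by_contra! hcon
    refine (Set.Ioo_infinite (show (-1 : ℝ) < 1 by norm_num)) ?_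
    refine (jacobiPoly n α β).roots.toFinset.finite_toSet.subset fun x hx => ?_
    have h := hcon (Real.arccos x) ⟨Real.arccos_pos.2 hx.2, by
      refine lt_of_le_of_ne (Real.arccos_le_pi x) fun h => ?_
      exact absurd (Real.arccos_eq_pi.1 h) (not_le.2 hx.1)⟩
    rw [Real.cos_arccos hx.1.le hx.2.le, ← eval_jacobiPoly] at h
    simpa [hne] using h
  constructor
  · obtain ⟨θ, hθ, h⟩ := key (m + 1 / 2) (m - 1 / 2) (by linarith) (by linarith)
    have hs := Real.rpow_pos_of_pos (Real.sin_pos_of_mem_Ioo hθ) m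
    have hp : 0 < √(1 - Real.cos θ) := Real.sqrt_pos.2 (by linarith [(cos_mem_Ioo hθ).2])
    exact ⟨θ, hθ, mul_ne_zero (mul_pos hs hp).ne' h⟩
  · obtain ⟨θ, hθ, h⟩ := key (m - 1 / 2) (m + 1 / 2) (by linarith) (by linarith)
    have hs := Real.rpow_pos_of_pos (Real.sin_pos_of_mem_Ioo hθ) m
    have hp : 0 < √(1 + Real.cos θ) := Real.sqrt_pos.2 (by linarith [(cos_mem_Ioo hθ).1])
    exact ⟨θ, hθ, mul_ne_zero (mul_pos hs hp).ne' h⟩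

theorem angular_ne_zero {m : ℝ} (hm : 1 / 2 ≤ m ∨ ∃ k : ℤ, m = (k : ℝ) + 1 / 2) {n : ℕ}
    (hn : 0 ≤ (n : ℝ) + 2 * m) : ∃ θ ∈ Set.Ioo 0 Real.pi, angularFst m n θ ≠ 0 := by
  rcases half_le_or_exists_eq_neg hm with h | ⟨k, rfl⟩
  · exact (angular_ne_zero_of_half_le h n).1
  · obtain ⟨j, rfl⟩ := exists_add_of_nonneg_add hn
    obtain ⟨θ, hθ, h⟩ := (angular_ne_zero_of_half_le (m := k + 1 / 2)
      (by linarith [Nat.cast_nonneg (α := ℝ) k]) j).2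
    refine ⟨θ, hθ, ?_⟩
    rw [angularFst_neg j k hθ]
    exact mul_ne_zero (by positivity) h

/-! ### Square integrable solutions and vanishing boundary terms -/

/-- `(f, g)` is a square integrable solution on `(0, π)` of the system
`f' = -(m / sin) f - z g`, `g' = (m / sin) g + z f` satisfied by `√sin S` for an eigenfunction
`S` of the angular operator without rotation. -/
structure IsReducedSolution (m : ℝ) (z : ℂ) (f g : ℝ → ℂ) : Prop where
  deriv_fst : ∀ θ ∈ Set.Ioo 0 Real.pi,
    HasDerivAt f (-((m / Real.sin θ : ℝ) : ℂ) * f θ - z * g θ) θ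
  deriv_snd : ∀ θ ∈ Set.Ioo 0 Real.pi,
    HasDerivAt g (((m / Real.sin θ : ℝ) : ℂ) * g θ + z * f θ) θ
  int_fst : MeasureTheory.IntegrableOn (fun θ => ‖f θ‖ ^ 2) (Set.Ioo 0 Real.pi)
  int_snd : MeasureTheory.IntegrableOn (fun θ => ‖g θ‖ ^ 2) (Set.Ioo 0 Real.pi)

theorem IsReducedSolution.continuousOn_fst {m : ℝ} {z : ℂ} {f g : ℝ → ℂ}
    (h : IsReducedSolution m z f g) : ContinuousOn f (Set.Ioo 0 Real.pi) :=
  fun θ hθ => (h.deriv_fst θ hθ).continuousAt.continuousWithinAt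

theorem IsReducedSolution.continuousOn_snd {m : ℝ} {z : ℂ} {f g : ℝ → ℂ}
    (h : IsReducedSolution m z f g) : ContinuousOn g (Set.Ioo 0 Real.pi) :=
  fun θ hθ => (h.deriv_snd θ hθ).continuousAt.continuousWithinAt

open MeasureTheory Set in
theorem integrableOn_norm_sq_sub_mul {f p : ℝ → ℂ} (c : ℂ) (hf : ContinuousOn f (Ioo 0 Real.pi))
    (hp : ContinuousOn p (Ioo 0 Real.pi))
    (hfi : IntegrableOn (fun θ => ‖f θ‖ ^ 2) (Ioo 0 Real.pi))
    (hpi : IntegrableOn (fun θ => ‖p θ‖ ^ 2) (Ioo 0 Real.pi)) :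
    IntegrableOn (fun θ => ‖f θ - c * p θ‖ ^ 2) (Ioo 0 Real.pi) := by
  have h1 := (memLp_two_iff_integrable_sq_norm (hf.aestronglyMeasurable measurableSet_Ioo)).2 hfi
  have h2 := (memLp_two_iff_integrable_sq_norm (hp.aestronglyMeasurable measurableSet_Ioo)).2 hpi
  exact (memLp_two_iff_integrable_sq_norm ((hf.sub (continuousOn_const.mul hp)).aestronglyMeasurable
    measurableSet_Ioo)).1 (h1.sub (h2.const_mul c))

theorem IsReducedSolution.sub_mul {m : ℝ} {z : ℂ} {f g p q : ℝ → ℂ}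
    (h : IsReducedSolution m z f g) (h' : IsReducedSolution m z p q) (c : ℂ) :
    IsReducedSolution m z (fun θ => f θ - c * p θ) (fun θ => g θ - c * q θ) where
  deriv_fst θ hθ := by
    exact ((h.deriv_fst θ hθ).fun_sub ((h'.deriv_fst θ hθ).const_mul c)).congr_deriv (by ring)
  deriv_snd θ hθ := by
    exact ((h.deriv_snd θ hθ).fun_sub ((h'.deriv_snd θ hθ).const_mul c)).congr_deriv (by ring)
  int_fst := integrableOn_norm_sq_sub_mul c h.continuousOn_fst h'.continuousOn_fst
    h.int_fst h'.int_fst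
  int_snd := integrableOn_norm_sq_sub_mul c h.continuousOn_snd h'.continuousOn_snd
    h.int_snd h'.int_snd

open MeasureTheory Set in
theorem not_integrableOn_of_inv_le {K : ℝ → ℝ} {a b c : ℝ} (hab : a < b) (hc : c = a ∨ c = b)
    (h : ∀ x ∈ Ioo a b, |x - c|⁻¹ ≤ K x) : ¬ IntegrableOn K (Ioo a b) := by
  intro hK
  have h1 : IntegrableOn (fun x => (x - c)⁻¹) (Ioo a b) := by
    refine Integrable.mono' hK (by fun_prop) ?_
    filter_upwards [ae_restrict_mem measurableSet_Ioo] with x hx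
    rw [norm_inv, Real.norm_eq_abs]
    exact h x hx
  have h2 := (intervalIntegrable_iff_integrableOn_Ioo_of_le hab.le).2 h1
  rcases intervalIntegrable_sub_inv_iff.1 h2 with h3 | h3
  · exact hab.ne h3
  · rcases hc with rfl | rfl
    · exact h3 left_mem_uIcc
    · exact h3 right_mem_uIcc

open MeasureTheory Set Filter Topology in
-- Near an endpoint c, sin θ ≤ |θ - c|. A nonzero limit would force K to dominate a multiple of 1/|θ
-- - c|, which is not integrable.
theorem eq_zero_of_tendsto_of_norm_sq_le {W : ℝ → ℂ} {K : ℝ → ℝ} {c : ℝ} {L : ℂ}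
    (hc : c = 0 ∨ c = Real.pi) (hK : IntegrableOn K (Ioo 0 Real.pi))
    (hb : ∀ θ ∈ Ioo 0 Real.pi, ‖W θ‖ ^ 2 ≤ Real.sin θ * K θ)
    (hW : Tendsto W (𝓝[Ioo 0 Real.pi] c) (𝓝 L)) : L = 0 := by
  by_contra hL
  have hL' : 0 < ‖L‖ := norm_pos_iff.2 hL
  have h1 : ∀ᶠ x in 𝓝[Ioo 0 Real.pi] c, ‖L‖ / 2 < ‖W x‖ :=
    hW.norm.eventually (lt_mem_nhds (by linarith))
  rw [eventually_nhdsWithin_iff, Metric.eventually_nhds_iff] at h1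
  obtain ⟨δ, hδ, h1⟩ := h1
  have hpi := Real.pi_pos
  have key : ∀ x ∈ Ioo 0 Real.pi, |x - c| < δ → |x - c|⁻¹ ≤ (2 / ‖L‖) ^ 2 * K x := by
    intro x hx hxc
    have h2 := h1 (by rwa [Real.dist_eq]) hx
    have h3 := hb x hx
    have hs := Real.sin_pos_of_mem_Ioo hx
    have hsx : Real.sin x ≤ |x - c| := by
      rcases hc with rfl | rfl
      · rw [sub_zero, abs_of_pos hx.1]; exact Real.sin_le hx.1.le
      · rw [← Real.sin_pi_sub, abs_sub_comm, abs_of_pos (by linarith [hx.2])]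
        exact Real.sin_le (by linarith [hx.2])
    have h4 : (‖L‖ / 2) ^ 2 ≤ Real.sin x * K x :=
      (pow_le_pow_left₀ (by positivity) h2.le 2).trans h3
    have hK0 : 0 < K x := pos_of_mul_pos_right ((by positivity : 0 < (‖L‖ / 2) ^ 2).trans_le h4) hs.le
    have h5 : (‖L‖ / 2) ^ 2 ≤ |x - c| * K x :=
      h4.trans (mul_le_mul_of_nonneg_right hsx hK0.le)
    rw [inv_le_iff_one_le_mul₀ (hs.trans_le hsx)]
    calc (1 : ℝ) = (2 / ‖L‖) ^ 2 * (‖L‖ / 2) ^ 2 := by field_simp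
      _ ≤ (2 / ‖L‖) ^ 2 * (|x - c| * K x) := by gcongr
      _ = _ := by ring
  have hK' := hK.const_mul ((2 / ‖L‖) ^ 2)
  have hd : 0 < min δ Real.pi := lt_min hδ hpi
  have hd1 := min_le_left δ Real.pi
  have hd2 := min_le_right δ Real.pi
  rcases hc with rfl | rfl
  · refine not_integrableOn_of_inv_le hd (Or.inl rfl) (fun x hx => key x ?_ ?_)
      (IntegrableOn.mono_set hK' (Ioo_subset_Ioo_right hd2))
    · exact ⟨hx.1, hx.2.trans_le hd2⟩
    · rw [sub_zero, abs_of_pos hx.1]; exact hx.2.trans_le hd1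
  · refine not_integrableOn_of_inv_le (a := Real.pi - min δ Real.pi) (b := Real.pi) (by linarith)
      (Or.inr rfl) (fun x hx => key x ?_ ?_)
      (IntegrableOn.mono_set hK' (Ioo_subset_Ioo_left (by linarith)))
    · exact ⟨by linarith [hx.1], hx.2⟩
    · rw [abs_sub_comm, abs_of_pos (by linarith [hx.2])]; linarith [hx.1]

open MeasureTheory Set Filter Topology in
-- Integrability of W' extends W continuously to [0, π]; the bound forces both endpoint values to be
-- zero, so the fundamental theorem of calculus gives the claim.
theorem integral_eq_zero_of_hasDerivAt_of_norm_sq_le {W W' : ℝ → ℂ} {K : ℝ → ℝ}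
    (hd : ∀ θ ∈ Ioo 0 Real.pi, HasDerivAt W (W' θ) θ) (hW' : IntegrableOn W' (Ioo 0 Real.pi))
    (hK : IntegrableOn K (Ioo 0 Real.pi))
    (hb : ∀ θ ∈ Ioo 0 Real.pi, ‖W θ‖ ^ 2 ≤ Real.sin θ * K θ) :
    ∫ θ in Ioo 0 Real.pi, W' θ = 0 := by
  have hpi := Real.pi_pos
  have hi : IntervalIntegrable W' volume 0 Real.pi :=
    (intervalIntegrable_iff_integrableOn_Ioo_of_le hpi.le).2 hW'
  have hmid : Real.pi / 2 ∈ Ioo 0 Real.pi := ⟨by linarith, by linarith⟩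
  have hsub : ∀ {x y}, x ∈ Icc 0 Real.pi → y ∈ Icc 0 Real.pi → IntervalIntegrable W' volume x y :=
    fun hx hy => hi.mono_set (uIcc_subset_uIcc (by rwa [uIcc_of_le hpi.le])
      (by rwa [uIcc_of_le hpi.le]))
  have hprim : ContinuousOn (fun x => W (Real.pi / 2) + ∫ y in (Real.pi / 2)..x, W' y)
      (Icc 0 Real.pi) := by
    have := intervalIntegral.continuousOn_primitive_interval' hi
      (by rw [uIcc_of_le hpi.le]; exact Ioo_subset_Icc_self hmid)
    rw [uIcc_of_le hpi.le] at this
    exact continuousOn_const.add this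
  have heq : ∀ x ∈ Ioo 0 Real.pi, W (Real.pi / 2) + ∫ y in (Real.pi / 2)..x, W' y = W x := by
    intro x hx
    rw [intervalIntegral.integral_eq_sub_of_hasDerivAt
      (fun y hy => hd y ((ordConnected_Ioo.uIcc_subset hmid hx) hy))
      (hsub (Ioo_subset_Icc_self hmid) (Ioo_subset_Icc_self hx))]
    ring
  have hlim : ∀ c ∈ Icc 0 Real.pi, (c = 0 ∨ c = Real.pi) →
      W (Real.pi / 2) + ∫ y in (Real.pi / 2)..c, W' y = 0 := by
    intro c hc hc'
    refine eq_zero_of_tendsto_of_norm_sq_le hc' hK hb ?_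
    have h1 : Tendsto _ (𝓝[Ioo 0 Real.pi] c) _ := (hprim c hc).mono_left
      (nhdsWithin_mono c Ioo_subset_Icc_self)
    refine h1.congr' ?_
    filter_upwards [self_mem_nhdsWithin] with x hx using heq x hx
  have h0 := hlim 0 ⟨le_rfl, hpi.le⟩ (Or.inl rfl)
  have h1 := hlim Real.pi ⟨hpi.le, le_rfl⟩ (Or.inr rfl)
  rw [← integral_Ioc_eq_integral_Ioo, ← intervalIntegral.integral_of_le hpi.le,
    ← intervalIntegral.integral_add_adjacent_intervals
      (hsub ⟨le_rfl, hpi.le⟩ (Ioo_subset_Icc_self hmid))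
      (hsub (Ioo_subset_Icc_self hmid) ⟨hpi.le, le_rfl⟩), intervalIntegral.integral_symm]
  linear_combination h1 - h0

open MeasureTheory Set in
theorem integrableOn_mul_of_bound {f p : ℝ → ℂ} {C : ℝ} (hf : ContinuousOn f (Ioo 0 Real.pi))
    (hp : ContinuousOn p (Ioo 0 Real.pi))
    (hfi : IntegrableOn (fun θ => ‖f θ‖ ^ 2) (Ioo 0 Real.pi))
    (hC0 : 0 ≤ C) (hC : ∀ θ ∈ Ioo 0 Real.pi, ‖p θ‖ ≤ C * √(Real.sin θ)) :
    IntegrableOn (fun θ => f θ * p θ) (Ioo 0 Real.pi) := by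
  have h1 : IntegrableOn (fun θ => C * (1 + ‖f θ‖ ^ 2)) (Ioo 0 Real.pi) :=
    ((integrableOn_const (by simp)).add hfi).const_mul C
  refine Integrable.mono' h1 ((hf.mul hp).aestronglyMeasurable measurableSet_Ioo) ?_
  filter_upwards [ae_restrict_mem measurableSet_Ioo] with θ hθ
  have h2 : ‖p θ‖ ≤ C := (hC θ hθ).trans (mul_le_of_le_one_right hC0
    (Real.sqrt_le_one.2 (Real.sin_le_one θ)))
  rw [norm_mul, mul_comm]
  refine mul_le_mul h2 ?_ (norm_nonneg _) hC0
  nlinarith [sq_nonneg (‖f θ‖ - 1), norm_nonneg (f θ)]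

open MeasureTheory Set in
theorem IsReducedSolution.integral_eq_zero {m : ℝ} {z w : ℂ} {f g p q : ℝ → ℂ} {C : ℝ}
    (h : IsReducedSolution m z f g) (h' : IsReducedSolution m w p q) (hzw : z ≠ w) (hC0 : 0 ≤ C)
    (hp : ∀ θ ∈ Ioo 0 Real.pi, ‖p θ‖ ≤ C * √(Real.sin θ))
    (hq : ∀ θ ∈ Ioo 0 Real.pi, ‖q θ‖ ≤ C * √(Real.sin θ)) :
    ∫ θ in Ioo 0 Real.pi, (f θ * p θ + g θ * q θ) = 0 := by
  have hi := (integrableOn_mul_of_bound h.continuousOn_fst h'.continuousOn_fst h.int_fst hC0 hp).add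
    (integrableOn_mul_of_bound h.continuousOn_snd h'.continuousOn_snd h.int_snd hC0 hq)
  have hK : IntegrableOn (fun θ => 2 * C ^ 2 * (‖f θ‖ ^ 2 + ‖g θ‖ ^ 2)) (Ioo 0 Real.pi) :=
    Integrable.const_mul (Integrable.add h.int_fst h.int_snd) _
  have h0 := integral_eq_zero_of_hasDerivAt_of_norm_sq_le
    -- In the derivative of the Wronskian the m/sin terms cancel, as do all terms but (w - z)(f p +
    -- g q).
    (W := fun θ => f θ * q θ - g θ * p θ)
    (W' := fun θ => (w - z) * (f θ * p θ + g θ * q θ))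
    (K := fun θ => 2 * C ^ 2 * (‖f θ‖ ^ 2 + ‖g θ‖ ^ 2)) ?_ (hi.const_mul _)
    hK ?_
  · rw [integral_const_mul] at h0
    exact (mul_eq_zero.1 h0).resolve_left (sub_ne_zero.2 hzw.symm)
  · intro θ hθ
    exact (((h.deriv_fst θ hθ).fun_mul (h'.deriv_snd θ hθ)).fun_sub
      ((h.deriv_snd θ hθ).fun_mul (h'.deriv_fst θ hθ))).congr_deriv (by ring)
  · intro θ hθ
    have hs := (Real.sin_pos_of_mem_Ioo hθ).le
    have h1 : ‖f θ * q θ - g θ * p θ‖ ≤ C * √(Real.sin θ) * (‖f θ‖ + ‖g θ‖) := by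
      refine (norm_sub_le _ _).trans ?_
      rw [norm_mul, norm_mul]
      nlinarith [mul_le_mul_of_nonneg_left (hq θ hθ) (norm_nonneg (f θ)),
        mul_le_mul_of_nonneg_left (hp θ hθ) (norm_nonneg (g θ))]
    refine (pow_le_pow_left₀ (norm_nonneg _) h1 2).trans ?_
    rw [mul_pow, mul_pow, Real.sq_sqrt hs]
    have h2 : (‖f θ‖ + ‖g θ‖) ^ 2 ≤ 2 * (‖f θ‖ ^ 2 + ‖g θ‖ ^ 2) := by
      nlinarith [sq_nonneg (‖f θ‖ - ‖g θ‖)]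
    calc C ^ 2 * Real.sin θ * (‖f θ‖ + ‖g θ‖) ^ 2
        ≤ C ^ 2 * Real.sin θ * (2 * (‖f θ‖ ^ 2 + ‖g θ‖ ^ 2)) := by gcongr
      _ = _ := by ring

/-! ### Pairings with the Jacobi solutions -/

open MeasureTheory Set in
theorem angular_isReducedSolution {m : ℝ} (hm : 1 / 2 ≤ m ∨ ∃ k : ℤ, m = (k : ℝ) + 1 / 2) {n : ℕ}
    (hn : 0 ≤ (n : ℝ) + 2 * m) {ε : ℝ} (hε : ε = 1 ∨ ε = -1) :
    IsReducedSolution m ((ε * ((n : ℝ) + 1 / 2 + m) : ℝ) : ℂ)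
      (fun θ => ((ε * angularFst m n θ : ℝ) : ℂ)) (fun θ => ((-angularSnd m n θ : ℝ) : ℂ)) := by
  have hε2 : ε * ε = 1 := by rcases hε with rfl | rfl <;> norm_num
  have hεn : |ε| = 1 := by rcases hε with rfl | rfl <;> norm_num
  have hsq : ∀ G : ℝ → ℝ, ContinuousOn G (Ioo 0 Real.pi) →
      (∃ C, ∀ θ ∈ Ioo 0 Real.pi, |G θ| ≤ C * √(Real.sin θ)) →
      IntegrableOn (fun θ => ‖((G θ : ℝ) : ℂ)‖ ^ 2) (Ioo 0 Real.pi) := by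
    rintro G hG ⟨C, hC⟩
    refine Integrable.mono' (g := fun _ => C ^ 2) (integrableOn_const (by simp))
      (((Complex.continuous_ofReal.comp_continuousOn hG).norm.pow 2).aestronglyMeasurable
        measurableSet_Ioo) ?_
    filter_upwards [ae_restrict_mem measurableSet_Ioo] with θ hθ
    rw [norm_pow, norm_norm, Complex.norm_real, Real.norm_eq_abs]
    refine (pow_le_pow_left₀ (abs_nonneg _) (hC θ hθ) 2).trans ?_
    rw [mul_pow, Real.sq_sqrt (Real.sin_pos_of_mem_Ioo hθ).le]
    exact mul_le_of_le_one_right (sq_nonneg C) (Real.sin_le_one θ)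
  obtain ⟨C, -, hC⟩ := angular_bound hm hn
  refine ⟨fun θ hθ => ?_, fun θ hθ => ?_, hsq _ ?_ ⟨C, fun θ hθ => ?_⟩,
    hsq _ ?_ ⟨C, fun θ hθ => ?_⟩⟩
  · convert ((hasDerivAt_angularFst m n hθ).const_mul ε).ofReal_comp using 1
    push_cast
    ring
  · convert (hasDerivAt_angularSnd m n hθ).fun_neg.ofReal_comp using 1
    have : (ε : ℂ) * ε = 1 := by exact_mod_cast hε2
    push_cast
    linear_combination ((n : ℂ) + 1 / 2 + m) * angularFst m n θ * this
  · exact fun θ hθ => ((hasDerivAt_angularFst m n hθ).const_mul ε).continuousAt.continuousWithinAt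
  · rw [abs_mul, hεn, one_mul]; exact (hC θ hθ).1
  · exact fun θ hθ => (hasDerivAt_angularSnd m n hθ).fun_neg.continuousAt.continuousWithinAt
  · rw [abs_neg]; exact (hC θ hθ).2

/-- The bilinear pairing of a spinor `(f, g)` with the angular solution of index `(n, ε)`. -/
noncomputable def angularPairing (m : ℝ) (n : ℕ) (ε : ℝ) (f g : ℝ → ℂ) : ℂ :=
  ∫ θ in Set.Ioo 0 Real.pi, (f θ * ((ε * angularFst m n θ : ℝ) : ℂ) +
    g θ * ((-angularSnd m n θ : ℝ) : ℂ))

theorem norm_angular_le {m : ℝ} (hm : 1 / 2 ≤ m ∨ ∃ k : ℤ, m = (k : ℝ) + 1 / 2) {n : ℕ}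
    (hn : 0 ≤ (n : ℝ) + 2 * m) {ε : ℝ} (hε : ε = 1 ∨ ε = -1) :
    ∃ C : ℝ, 0 ≤ C ∧
      (∀ θ ∈ Set.Ioo 0 Real.pi, ‖((ε * angularFst m n θ : ℝ) : ℂ)‖ ≤ C * √(Real.sin θ)) ∧
      ∀ θ ∈ Set.Ioo 0 Real.pi, ‖((-angularSnd m n θ : ℝ) : ℂ)‖ ≤ C * √(Real.sin θ) := by
  have hεn : |ε| = 1 := by rcases hε with rfl | rfl <;> norm_num
  obtain ⟨C, hC0, hC⟩ := angular_bound hm hn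
  refine ⟨C, hC0, fun θ hθ => ?_, fun θ hθ => ?_⟩
  · rw [Complex.norm_real, Real.norm_eq_abs, abs_mul, hεn, one_mul]; exact (hC θ hθ).1
  · rw [Complex.norm_real, Real.norm_eq_abs, abs_neg]; exact (hC θ hθ).2

theorem IsReducedSolution.angularPairing_eq_zero {m : ℝ}
    (hm : 1 / 2 ≤ m ∨ ∃ k : ℤ, m = (k : ℝ) + 1 / 2) {z : ℂ} {f g : ℝ → ℂ}
    (h : IsReducedSolution m z f g) {n : ℕ} (hn : 0 ≤ (n : ℝ) + 2 * m) {ε : ℝ}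
    (hε : ε = 1 ∨ ε = -1) (hz : z ≠ ((ε * ((n : ℝ) + 1 / 2 + m) : ℝ) : ℂ)) :
    angularPairing m n ε f g = 0 := by
  obtain ⟨C, hC0, h1, h2⟩ := norm_angular_le hm hn hε
  exact h.integral_eq_zero (angular_isReducedSolution hm hn hε) hz hC0 h1 h2

open MeasureTheory Set in
theorem IsReducedSolution.integrableOn_pairing {m : ℝ}
    (hm : 1 / 2 ≤ m ∨ ∃ k : ℤ, m = (k : ℝ) + 1 / 2) {z : ℂ} {f g : ℝ → ℂ}
    (h : IsReducedSolution m z f g) {n : ℕ} (hn : 0 ≤ (n : ℝ) + 2 * m) {ε : ℝ}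
    (hε : ε = 1 ∨ ε = -1) :
    IntegrableOn (fun θ => f θ * ((ε * angularFst m n θ : ℝ) : ℂ) +
      g θ * ((-angularSnd m n θ : ℝ) : ℂ)) (Ioo 0 Real.pi) := by
  obtain ⟨C, hC0, h1, h2⟩ := norm_angular_le hm hn hε
  have h' := angular_isReducedSolution hm hn hε
  exact (integrableOn_mul_of_bound h.continuousOn_fst h'.continuousOn_fst h.int_fst hC0 h1).add
    (integrableOn_mul_of_bound h.continuousOn_snd h'.continuousOn_snd h.int_snd hC0 h2)

open MeasureTheory Set in
theorem IsReducedSolution.integrableOn {m : ℝ} {z : ℂ} {f g : ℝ → ℂ}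
    (h : IsReducedSolution m z f g) :
    IntegrableOn f (Ioo 0 Real.pi) ∧ IntegrableOn g (Ioo 0 Real.pi) := by
  have key : ∀ {u : ℝ → ℂ}, ContinuousOn u (Ioo 0 Real.pi) →
      IntegrableOn (fun θ => ‖u θ‖ ^ 2) (Ioo 0 Real.pi) → IntegrableOn u (Ioo 0 Real.pi) := by
    intro u hu hi
    exact ((memLp_two_iff_integrable_sq_norm
      (hu.aestronglyMeasurable measurableSet_Ioo)).2 hi).integrable (by norm_num)
  exact ⟨key h.continuousOn_fst h.int_fst, key h.continuousOn_snd h.int_snd⟩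

open MeasureTheory Set in
-- The sign ε enters only the first component, so the difference of the pairings for ε = 1 and ε =
-- -1 isolates f and their sum isolates g; completeness then applies to each.
theorem IsReducedSolution.eqOn_zero {m : ℝ}
    (hm : 1 / 2 ≤ m ∨ ∃ k : ℤ, m = (k : ℝ) + 1 / 2) {z : ℂ} {f g : ℝ → ℂ}
    (h : IsReducedSolution m z f g)
    (h0 : ∀ n : ℕ, 0 ≤ (n : ℝ) + 2 * m → ∀ ε : ℝ, (ε = 1 ∨ ε = -1) →
      angularPairing m n ε f g = 0) :
    EqOn f 0 (Ioo 0 Real.pi) ∧ EqOn g 0 (Ioo 0 Real.pi) := by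
  obtain ⟨hf, hg⟩ := h.integrableOn
  constructor
  · refine (angular_complete hm hf h.continuousOn_fst).1 fun n hn => ?_
    have h1 := h0 n hn 1 (Or.inl rfl)
    have h2 := h0 n hn (-1) (Or.inr rfl)
    have i1 := h.integrableOn_pairing hm hn (Or.inl rfl)
    have i2 := h.integrableOn_pairing hm hn (Or.inr rfl)
    have h3 := integral_sub i1 i2
    simp only [angularPairing] at h1 h2
    rw [h1, h2, sub_zero] at h3
    have h4 : ∫ θ in Ioo 0 Real.pi, (2 : ℂ) * (angularFst m n θ • f θ) = 0 := by
      rw [← h3]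
      refine integral_congr_ae (Filter.Eventually.of_forall fun θ => ?_)
      simp only [Complex.real_smul]; push_cast; ring
    rw [integral_const_mul] at h4
    exact (mul_eq_zero.1 h4).resolve_left two_ne_zero
  · refine (angular_complete hm hg h.continuousOn_snd).2 fun n hn => ?_
    have h1 := h0 n hn 1 (Or.inl rfl)
    have h2 := h0 n hn (-1) (Or.inr rfl)
    have i1 := h.integrableOn_pairing hm hn (Or.inl rfl)
    have i2 := h.integrableOn_pairing hm hn (Or.inr rfl)
    have h3 := integral_add i1 i2
    simp only [angularPairing] at h1 h2
    rw [h1, h2, add_zero] at h3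
    have h4 : ∫ θ in Ioo 0 Real.pi, (-2 : ℂ) * (angularSnd m n θ • g θ) = 0 := by
      rw [← h3]
      refine integral_congr_ae (Filter.Eventually.of_forall fun θ => ?_)
      simp only [Complex.real_smul]; push_cast; ring
    rw [integral_const_mul] at h4
    exact (mul_eq_zero.1 h4).resolve_left (by norm_num)

theorem angular_eigenvalue_pos {m : ℝ} (hm : 1 / 2 ≤ m ∨ ∃ k : ℤ, m = (k : ℝ) + 1 / 2) {n : ℕ}
    (hn : 0 ≤ (n : ℝ) + 2 * m) : 0 < (n : ℝ) + 1 / 2 + m := by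
  rcases half_le_or_exists_eq_neg hm with h | ⟨k, rfl⟩
  · positivity
  · linarith [Nat.cast_nonneg (α := ℝ) k]

open MeasureTheory Set in
theorem IsReducedSolution.exists_eq_mul {m : ℝ}
    (hm : 1 / 2 ≤ m ∨ ∃ k : ℤ, m = (k : ℝ) + 1 / 2) {n : ℕ} (hn : 0 ≤ (n : ℝ) + 2 * m) {ε : ℝ}
    (hε : ε = 1 ∨ ε = -1) {f g : ℝ → ℂ}
    (h : IsReducedSolution m ((ε * ((n : ℝ) + 1 / 2 + m) : ℝ) : ℂ) f g) :
    ∃ c : ℂ, ∀ θ ∈ Ioo 0 Real.pi, f θ = c * ((ε * angularFst m n θ : ℝ) : ℂ) ∧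
      g θ = c * ((-angularSnd m n θ : ℝ) : ℂ) := by
  have hG := angular_isReducedSolution hm hn hε
  have hne : ∀ k : ℕ, 0 ≤ (k : ℝ) + 2 * m → ∀ δ : ℝ, (δ = 1 ∨ δ = -1) → (k ≠ n ∨ δ ≠ ε) →
      ((ε * ((n : ℝ) + 1 / 2 + m) : ℝ) : ℂ) ≠ ((δ * ((k : ℝ) + 1 / 2 + m) : ℝ) : ℂ) := by
    intro k hk δ hδ hkδ heq
    have h1 := angular_eigenvalue_pos hm hn
    have h2 := angular_eigenvalue_pos hm hk
    have h3 : ε * ((n : ℝ) + 1 / 2 + m) = δ * ((k : ℝ) + 1 / 2 + m) := by exact_mod_cast heq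
    -- Both n + 1/2 + m and k + 1/2 + m are positive, so the sign of the eigenvalue determines ε and
    -- its modulus determines n.
    have h4 : δ = ε := by rcases hε with rfl | rfl <;> rcases hδ with rfl | rfl <;> linarith
    subst h4
    have h5 : (k : ℝ) = n := by rcases hδ with rfl | rfl <;> linarith
    exact hkδ.elim (fun h => h (by exact_mod_cast h5)) fun h => h rfl
  set N : ℂ := angularPairing m n ε (fun θ => ((ε * angularFst m n θ : ℝ) : ℂ))
    (fun θ => ((-angularSnd m n θ : ℝ) : ℂ)) with hN
  -- If the self-pairing vanished, the Jacobi solution would pair to zero with all of them, hence be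
  -- zero by completeness.
  have hN0 : N ≠ 0 := by
    intro hN0
    have h1 := hG.eqOn_zero hm fun k hk δ hδ => by
      by_cases hc : k = n ∧ δ = ε
      · rw [hc.1, hc.2, ← hN, hN0]
      · exact hG.angularPairing_eq_zero hm hk hδ (hne k hk δ hδ (by tauto))
    obtain ⟨θ, hθ, h2⟩ := angular_ne_zero hm hn
    have h3 : ε * angularFst m n θ = 0 := by simpa using h1.1 hθ
    rcases hε with rfl | rfl <;> simp_all
  -- The projection coefficient: subtracting c times the Jacobi solution cancels the one pairing not
  -- already zero by orthogonality.
  set c : ℂ := angularPairing m n ε f g / N with hc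
  have hsub := h.sub_mul hG c
  have h1 := hsub.eqOn_zero hm fun k hk δ hδ => by
    by_cases hkδ : k = n ∧ δ = ε
    · obtain ⟨rfl, rfl⟩ := hkδ
      have h2 := integral_sub (h.integrableOn_pairing hm hn hε)
        ((hG.integrableOn_pairing hm hn hε).const_mul c)
      rw [integral_const_mul] at h2
      have h3 : angularPairing m k δ f g - c * N = 0 := by rw [hc]; field_simp; ring
      rw [← h3, hN]
      simp only [angularPairing]
      rw [← h2]
      refine integral_congr_ae (Filter.Eventually.of_forall fun θ => ?_)
      ring
    · exact hsub.angularPairing_eq_zero hm hk hδ (hne k hk δ hδ (by tauto))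
  exact ⟨c, fun θ hθ => ⟨sub_eq_zero.1 (h1.1 hθ), sub_eq_zero.1 (h1.2 hθ)⟩⟩

/-! ### Passage between the angular operator and the reduced system -/

open MeasureTheory Set in
theorem memLp_angularMeasure_iff {F : ℝ → ℂ} (hF : ContinuousOn F (Ioo 0 Real.pi)) :
    MemLp F 2 angularMeasure ↔
      IntegrableOn (fun θ => ‖((√(Real.sin θ) : ℝ) : ℂ) * F θ‖ ^ 2) (Ioo 0 Real.pi) := by
  have hm : AEStronglyMeasurable F angularMeasure :=
    (hF.aestronglyMeasurable measurableSet_Ioo).mono_ac (withDensity_absolutelyContinuous _ _)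
  rw [memLp_two_iff_integrable_sq_norm hm, angularMeasure,
    integrable_withDensity_iff_integrable_smul' (by fun_prop)
    (Filter.Eventually.of_forall fun _ => ENNReal.ofReal_lt_top)]
  have h1 : IntegrableOn (fun θ => ‖((√(Real.sin θ) : ℝ) : ℂ) * F θ‖ ^ 2) (Ioo 0 Real.pi) ↔
      IntegrableOn (fun θ => 2 * ‖((√(Real.sin θ) : ℝ) : ℂ) * F θ‖ ^ 2) (Ioo 0 Real.pi) :=
    (integrable_const_mul_iff (isUnit_iff_ne_zero.2 two_ne_zero) _).symm
  rw [h1]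
  refine integrable_congr ?_
  filter_upwards [ae_restrict_mem measurableSet_Ioo] with θ hθ
  have hs := (Real.sin_pos_of_mem_Ioo hθ).le
  rw [ENNReal.toReal_ofReal (by positivity), norm_mul, mul_pow, Complex.norm_real,
    Real.norm_eq_abs, sq_abs, Real.sq_sqrt hs, smul_eq_mul, mul_assoc]

theorem angularOperator_zero_eq_smul_iff (ω μ m : ℝ) (z : ℂ) (S : ℝ → Fin 2 → ℂ) {θ : ℝ}
    (hθ : θ ∈ Set.Ioo 0 Real.pi) :
    angularOperator 0 ω μ m S θ = z • S θ ↔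
      deriv S θ 0 = -((Real.cos θ / (2 * Real.sin θ) : ℝ) : ℂ) * S θ 0 -
        ((m / Real.sin θ : ℝ) : ℂ) * S θ 0 - z * S θ 1 ∧
      deriv S θ 1 = -((Real.cos θ / (2 * Real.sin θ) : ℝ) : ℂ) * S θ 1 +
        ((m / Real.sin θ : ℝ) : ℂ) * S θ 1 + z * S θ 0 := by
  have hs : ((Real.sin θ : ℝ) : ℂ) ≠ 0 := by
    exact_mod_cast (Real.sin_pos_of_mem_Ioo hθ).ne'
  -- The matrix is off-diagonal in the derivative: the first row determines the derivative of the
  -- second component, hence the swap.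
  rw [funext_iff, Fin.forall_fin_two, and_comm]
  simp only [angularOperator, Matrix.mulVec, dotProduct, Fin.sum_univ_two, Pi.smul_apply,
    Pi.add_apply, smul_eq_mul, Matrix.of_apply, Matrix.cons_val', Matrix.cons_val_zero,
    Matrix.cons_val_one, Matrix.cons_val_fin_one, zero_mul, Complex.ofReal_zero, mul_zero]
  push_cast at hs ⊢
  refine and_congr ?_ ?_
  · constructor
    · intro h
      field_simp at h ⊢
      linear_combination -h
    · intro h
      rw [h]
      field_simp
      ring
  · constructor
    · intro h
      field_simp at h ⊢
      linear_combination h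
    · intro h
      rw [h]
      field_simp
      ring

/-- The logarithmic derivative cos/(2 sin) of √sin is exactly what cancels the cotangent term of the
operator. -/
theorem hasDerivAt_sqrt_sin {θ : ℝ} (hθ : θ ∈ Set.Ioo 0 Real.pi) :
    HasDerivAt (fun θ => ((√(Real.sin θ) : ℝ) : ℂ))
      (((Real.cos θ / (2 * Real.sin θ) : ℝ) : ℂ) * ((√(Real.sin θ) : ℝ) : ℂ)) θ := by
  have hs := Real.sin_pos_of_mem_Ioo hθ
  have hq : 0 < √(Real.sin θ) := Real.sqrt_pos.2 hs
  refine ((Real.hasDerivAt_sin θ).sqrt hs.ne').ofReal_comp.congr_deriv ?_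
  rw [← Complex.ofReal_mul, Complex.ofReal_inj]
  nth_rw 2 [← Real.mul_self_sqrt hs.le]
  field_simp

theorem hasDerivAt_inv_sqrt_sin {θ : ℝ} (hθ : θ ∈ Set.Ioo 0 Real.pi) :
    HasDerivAt (fun θ => (((√(Real.sin θ))⁻¹ : ℝ) : ℂ))
      (-((Real.cos θ / (2 * Real.sin θ) : ℝ) : ℂ) * (((√(Real.sin θ))⁻¹ : ℝ) : ℂ)) θ := by
  have hs := Real.sin_pos_of_mem_Ioo hθ
  have hq : 0 < √(Real.sin θ) := Real.sqrt_pos.2 hs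
  refine (((Real.hasDerivAt_sin θ).sqrt hs.ne').fun_inv hq.ne').ofReal_comp.congr_deriv ?_
  rw [← Complex.ofReal_neg, ← Complex.ofReal_mul, Complex.ofReal_inj]
  nth_rw 3 [← Real.mul_self_sqrt hs.le]
  field_simp

theorem IsAngularEigenfunction.isReducedSolution {ω μ m : ℝ} {z : ℂ} {S : ℝ → Fin 2 → ℂ}
    (h : IsAngularEigenfunction 0 ω μ m z S) :
    IsReducedSolution m z (fun θ => ((√(Real.sin θ) : ℝ) : ℂ) * S θ 0)
      (fun θ => ((√(Real.sin θ) : ℝ) : ℂ) * S θ 1) := by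
  have hd : ∀ θ ∈ Set.Ioo 0 Real.pi, ∀ i, HasDerivAt (fun θ => S θ i) (deriv S θ i) θ :=
    fun θ hθ => hasDerivAt_pi.1
      ((h.differentiableOn θ hθ).differentiableAt (isOpen_Ioo.mem_nhds hθ)).hasDerivAt
  have hc : ∀ i, ContinuousOn (fun θ => S θ i) (Set.Ioo 0 Real.pi) :=
    fun i θ hθ => (hd θ hθ i).continuousAt.continuousWithinAt
  refine ⟨fun θ hθ => ?_, fun θ hθ => ?_, (memLp_angularMeasure_iff (hc 0)).1 (h.memLp 0),
    (memLp_angularMeasure_iff (hc 1)).1 (h.memLp 1)⟩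
  · refine ((hasDerivAt_sqrt_sin hθ).fun_mul (hd θ hθ 0)).congr_deriv ?_
    rw [((angularOperator_zero_eq_smul_iff ω μ m z S hθ).1 (h.eigen θ hθ)).1]
    ring
  · refine ((hasDerivAt_sqrt_sin hθ).fun_mul (hd θ hθ 1)).congr_deriv ?_
    rw [((angularOperator_zero_eq_smul_iff ω μ m z S hθ).1 (h.eigen θ hθ)).2]
    ring

theorem IsReducedSolution.isAngularEigenfunction {ω μ m : ℝ} {z : ℂ} {f g : ℝ → ℂ}
    (h : IsReducedSolution m z f g) {S : ℝ → Fin 2 → ℂ}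
    (hS : ∀ θ ∈ Set.Ioo 0 Real.pi, S θ 0 = (((√(Real.sin θ))⁻¹ : ℝ) : ℂ) * f θ ∧
      S θ 1 = (((√(Real.sin θ))⁻¹ : ℝ) : ℂ) * g θ)
    (hne : ∃ θ ∈ Set.Ioo 0 Real.pi, f θ ≠ 0) : IsAngularEigenfunction 0 ω μ m z S := by
  have hd0 : ∀ θ ∈ Set.Ioo 0 Real.pi, HasDerivAt (fun θ => S θ 0)
      (-((Real.cos θ / (2 * Real.sin θ) : ℝ) : ℂ) * S θ 0 -
        ((m / Real.sin θ : ℝ) : ℂ) * S θ 0 - z * S θ 1) θ := by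
    intro θ hθ
    refine (((hasDerivAt_inv_sqrt_sin hθ).fun_mul (h.deriv_fst θ hθ)).congr_deriv ?_
      ).congr_of_eventuallyEq ?_
    · rw [(hS θ hθ).1, (hS θ hθ).2]; ring
    · filter_upwards [isOpen_Ioo.mem_nhds hθ] with x hx using (hS x hx).1
  have hd1 : ∀ θ ∈ Set.Ioo 0 Real.pi, HasDerivAt (fun θ => S θ 1)
      (-((Real.cos θ / (2 * Real.sin θ) : ℝ) : ℂ) * S θ 1 +
        ((m / Real.sin θ : ℝ) : ℂ) * S θ 1 + z * S θ 0) θ := by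
    intro θ hθ
    refine (((hasDerivAt_inv_sqrt_sin hθ).fun_mul (h.deriv_snd θ hθ)).congr_deriv ?_
      ).congr_of_eventuallyEq ?_
    · rw [(hS θ hθ).1, (hS θ hθ).2]; ring
    · filter_upwards [isOpen_Ioo.mem_nhds hθ] with x hx using (hS x hx).2
  have hd : ∀ θ ∈ Set.Ioo 0 Real.pi, DifferentiableAt ℝ S θ := fun θ hθ =>
    differentiableAt_pi.2 (Fin.forall_fin_two.2
      ⟨(hd0 θ hθ).differentiableAt, (hd1 θ hθ).differentiableAt⟩)
  have hderiv : ∀ θ ∈ Set.Ioo 0 Real.pi, ∀ i, HasDerivAt (fun θ => S θ i) (deriv S θ i) θ :=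
    fun θ hθ => hasDerivAt_pi.1 (hd θ hθ).hasDerivAt
  have hc : ∀ i, ContinuousOn (fun θ => S θ i) (Set.Ioo 0 Real.pi) :=
    fun i θ hθ => (hderiv θ hθ i).continuousAt.continuousWithinAt
  have hmul : ∀ θ ∈ Set.Ioo 0 Real.pi, ((√(Real.sin θ) : ℝ) : ℂ) * S θ 0 = f θ ∧
      ((√(Real.sin θ) : ℝ) : ℂ) * S θ 1 = g θ := by
    intro θ hθ
    have hq := (Real.sqrt_pos.2 (Real.sin_pos_of_mem_Ioo hθ)).ne'
    rw [(hS θ hθ).1, (hS θ hθ).2, ← mul_assoc, ← mul_assoc, ← Complex.ofReal_mul,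
      mul_inv_cancel₀ hq]
    simp
  refine ⟨fun θ hθ => (hd θ hθ).differentiableWithinAt, Fin.forall_fin_two.2 ⟨?_, ?_⟩,
    fun θ hθ => ?_, ?_⟩
  · refine (memLp_angularMeasure_iff (hc 0)).2 (h.int_fst.congr_fun (fun θ hθ => ?_)
      measurableSet_Ioo)
    simp only [(hmul θ hθ).1]
  · refine (memLp_angularMeasure_iff (hc 1)).2 (h.int_snd.congr_fun (fun θ hθ => ?_)
      measurableSet_Ioo)
    simp only [(hmul θ hθ).2]
  · exact (angularOperator_zero_eq_smul_iff ω μ m z S hθ).2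
      ⟨(hderiv θ hθ 0).unique (hd0 θ hθ), (hderiv θ hθ 1).unique (hd1 θ hθ)⟩
  · obtain ⟨θ, hθ, hf⟩ := hne
    refine ⟨θ, hθ, fun h0 => hf ?_⟩
    rw [← (hmul θ hθ).1, h0]
    simp

/-- Half-angle identities: sin θ tan(θ/2) = 1 - cos θ and sin θ cot(θ/2) = 1 + cos θ, with the extra
√sin moved under the root. -/
theorem sin_rpow_mul_sqrt_tan (m : ℝ) {θ : ℝ} (hθ : θ ∈ Set.Ioo 0 Real.pi) :
    Real.sin θ ^ (m + 1 / 2) * √(Real.tan (θ / 2)) = Real.sin θ ^ m * √(1 - Real.cos θ) ∧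
    Real.sin θ ^ (m + 1 / 2) * √(Real.cot (θ / 2)) = Real.sin θ ^ m * √(1 + Real.cos θ) := by
  have hs := Real.sin_pos_of_mem_Ioo hθ
  have h1 : 0 < Real.sin (θ / 2) :=
    Real.sin_pos_of_pos_of_lt_pi (by linarith [hθ.1]) (by linarith [hθ.1, hθ.2])
  have h2 : 0 < Real.cos (θ / 2) :=
    Real.cos_pos_of_mem_Ioo ⟨by linarith [hθ.1, hθ.2], by linarith [hθ.2]⟩
  have e1 : Real.sin θ = 2 * Real.sin (θ / 2) * Real.cos (θ / 2) := by
    rw [← Real.sin_two_mul]; ring_nf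
  have e2 : Real.cos θ = 2 * Real.cos (θ / 2) ^ 2 - 1 := by
    rw [← Real.cos_two_mul]; ring_nf
  have e3 := Real.sin_sq_add_cos_sq (θ / 2)
  rw [Real.rpow_add hs, ← Real.sqrt_eq_rpow, mul_assoc, mul_assoc, ← Real.sqrt_mul hs.le,
    ← Real.sqrt_mul hs.le, Real.tan_eq_sin_div_cos, Real.cot_eq_cos_div_sin]
  constructor
  · congr 2
    rw [e1, e2]
    field_simp
    linear_combination 2 * e3
  · congr 2
    rw [e1, e2]
    field_simp
    ring

theorem angularSpinor_jacobiP (m ε : ℝ) (n : ℕ) {θ : ℝ} (hθ : θ ∈ Set.Ioo 0 Real.pi) :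
    angularSpinor m (fun x => ε * jacobiP n (m + 1 / 2) (m - 1 / 2) x)
      (fun x => -jacobiP n (m - 1 / 2) (m + 1 / 2) x) θ =
    ![(((√(Real.sin θ))⁻¹ : ℝ) : ℂ) * ((ε * angularFst m n θ : ℝ) : ℂ),
      (((√(Real.sin θ))⁻¹ : ℝ) : ℂ) * ((-angularSnd m n θ : ℝ) : ℂ)] := by
  obtain ⟨h1, h2⟩ := sin_rpow_mul_sqrt_tan m hθ
  simp only [angularSpinor, angularFst, angularSnd, ← Complex.ofReal_mul, ← h1, ← h2]
  congr 3
  · ring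
  · congr 3; ring

theorem isAngularEigenfunction_iff {ω μ m : ℝ}
    (hm : 1 / 2 ≤ m ∨ ∃ k : ℤ, m = (k : ℝ) + 1 / 2) {n : ℕ} (hn : 0 ≤ (n : ℝ) + 2 * m) {ε : ℝ}
    (hε : ε = 1 ∨ ε = -1) (S : ℝ → Fin 2 → ℂ) :
    IsAngularEigenfunction 0 ω μ m ((ε * ((n : ℝ) + 1 / 2 + m) : ℝ) : ℂ) S ↔
      ∃ c : ℂ, c ≠ 0 ∧ ∀ θ ∈ Set.Ioo 0 Real.pi, S θ = c • angularSpinor m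
        (fun x => ε * jacobiP n (m + 1 / 2) (m - 1 / 2) x)
        (fun x => -jacobiP n (m - 1 / 2) (m + 1 / 2) x) θ := by
  constructor
  · intro h
    obtain ⟨c, hc⟩ := h.isReducedSolution.exists_eq_mul hm hn hε
    have hS : ∀ θ ∈ Set.Ioo 0 Real.pi, S θ = c • angularSpinor m
        (fun x => ε * jacobiP n (m + 1 / 2) (m - 1 / 2) x)
        (fun x => -jacobiP n (m - 1 / 2) (m + 1 / 2) x) θ := by
      intro θ hθ
      have hq : (((√(Real.sin θ)) : ℝ) : ℂ) ≠ 0 := by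
        exact_mod_cast (Real.sqrt_pos.2 (Real.sin_pos_of_mem_Ioo hθ)).ne'
      obtain ⟨h0, h1⟩ := hc θ hθ
      rw [angularSpinor_jacobiP m ε n hθ, funext_iff, Fin.forall_fin_two]
      simp only [Pi.smul_apply, Matrix.cons_val_zero, Matrix.cons_val_one, smul_eq_mul]
      constructor
      · rw [mul_left_comm, ← h0, ← mul_assoc, Complex.ofReal_inv, inv_mul_cancel₀ hq, one_mul]
      · rw [mul_left_comm, ← h1, ← mul_assoc, Complex.ofReal_inv, inv_mul_cancel₀ hq, one_mul]
    refine ⟨c, fun hc0 => ?_, hS⟩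
    obtain ⟨θ, hθ, hne⟩ := h.nonzero
    exact hne (by rw [hS θ hθ, hc0, zero_smul])
  · rintro ⟨c, hc, hS⟩
    have hG := angular_isReducedSolution hm hn hε
    -- The multiple c G is written as G - (1 - c) G, so closure under `sub_mul` suffices.
    refine (hG.sub_mul hG (1 - c)).isAngularEigenfunction (fun θ hθ => ?_) ?_
    · rw [hS θ hθ, angularSpinor_jacobiP m ε n hθ]
      simp only [Pi.smul_apply, Matrix.cons_val_zero, Matrix.cons_val_one, smul_eq_mul]
      constructor <;> ring
    · obtain ⟨θ, hθ, h⟩ := angular_ne_zero hm hn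
      refine ⟨θ, hθ, ?_⟩
      have hε0 : ε ≠ 0 := by rcases hε with rfl | rfl <;> norm_num
      have h1 : ((ε * angularFst m n θ : ℝ) : ℂ) ≠ 0 := by exact_mod_cast mul_ne_zero hε0 h
      convert mul_ne_zero hc h1 using 1
      ring

theorem isAngularEigenvalue_iff {ω μ m : ℝ}
    (hm : 1 / 2 ≤ m ∨ ∃ k : ℤ, m = (k : ℝ) + 1 / 2) (z : ℂ) :
    IsAngularEigenvalue 0 ω μ m z ↔ ∃ n : ℕ, 0 ≤ (n : ℝ) + 2 * m ∧
      (z = (((n : ℝ) + 1 / 2 + m : ℝ) : ℂ) ∨ z = ((-((n : ℝ) + 1 / 2 + m) : ℝ) : ℂ)) := by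
  constructor
  · rintro ⟨S, h⟩
    by_contra! hz
    -- A value outside the list differs from every Jacobi eigenvalue, so all pairings vanish and S
    -- would be zero.
    have h1 := h.isReducedSolution.eqOn_zero hm fun n hn ε hε =>
      h.isReducedSolution.angularPairing_eq_zero hm hn hε (by
        rcases hε with rfl | rfl
        · simpa only [one_mul] using (hz n hn).1
        · simpa only [neg_mul, one_mul] using (hz n hn).2)
    obtain ⟨θ, hθ, hne⟩ := h.nonzero
    have hq : (((√(Real.sin θ)) : ℝ) : ℂ) ≠ 0 := by
      exact_mod_cast (Real.sqrt_pos.2 (Real.sin_pos_of_mem_Ioo hθ)).ne'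
    refine hne (funext_iff.2 (Fin.forall_fin_two.2 ⟨?_, ?_⟩))
    · exact (mul_eq_zero.1 (h1.1 hθ)).resolve_left hq
    · exact (mul_eq_zero.1 (h1.2 hθ)).resolve_left hq
  · have key : ∀ n : ℕ, 0 ≤ (n : ℝ) + 2 * m → ∀ ε : ℝ, (ε = 1 ∨ ε = -1) →
        IsAngularEigenvalue 0 ω μ m ((ε * ((n : ℝ) + 1 / 2 + m) : ℝ) : ℂ) := fun n hn ε hε =>
      ⟨_, (isAngularEigenfunction_iff hm hn hε _).2
        ⟨1, one_ne_zero, fun θ _ => (one_smul ℂ _).symm⟩⟩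
    rintro ⟨n, hn, rfl | rfl⟩
    · simpa only [one_mul] using key n hn 1 (Or.inl rfl)
    · simpa only [neg_mul, one_mul] using key n hn (-1) (Or.inr rfl)

theorem mainTheorem7 (a ω μ m : ℝ) (ha : a = 0)
    (hm : 1 / 2 ≤ m ∨ ∃ k : ℤ, m = (k : ℝ) + 1 / 2) :
    {z : ℂ | IsAngularEigenvalue a ω μ m z} =
      {z : ℂ | ∃ n : ℕ, 0 ≤ (n : ℝ) + 2 * m ∧
        (z = (((n : ℝ) + 1 / 2 + m : ℝ) : ℂ) ∨ z = ((-((n : ℝ) + 1 / 2 + m) : ℝ) : ℂ))} ∧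
    ∀ n : ℕ, 0 ≤ (n : ℝ) + 2 * m → ∀ ε : ℝ, (ε = 1 ∨ ε = -1) →
      ∀ lam : ℝ, lam = ε * ((n : ℝ) + 1 / 2 + m) →
        (∀ S : ℝ → Fin 2 → ℂ, IsAngularEigenfunction a ω μ m (lam : ℂ) S ↔
          ∃ c : ℂ, c ≠ 0 ∧ ∀ θ ∈ Set.Ioo 0 Real.pi,
            S θ = c • angularSpinor m
              (fun x => ε * jacobiP n (m + 1 / 2) (m - 1 / 2) x)
              (fun x => -jacobiP n (m - 1 / 2) (m + 1 / 2) x) θ) ∧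
        (∀ u v : ℝ → ℝ, (∀ x, v x = -jacobiP n (m - 1 / 2) (m + 1 / 2) x) →
          (∀ x ∈ Set.Ioo (-1 : ℝ) 1,
            (1 + x) * deriv v x = -(m + 1 / 2) * v x - lam * u x) →
          ∀ x ∈ Set.Ioo (-1 : ℝ) 1,
            lam * u x = |lam| * jacobiP n (m + 1 / 2) (m - 1 / 2) x ∧
            u x = ε * jacobiP n (m + 1 / 2) (m - 1 / 2) x) := by
  subst ha
  refine ⟨Set.ext fun z => isAngularEigenvalue_iff hm z, ?_⟩
  rintro n hn ε hε lam rfl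
  refine ⟨fun S => isAngularEigenfunction_iff hm hn hε S, fun u v hv hu x hx => ?_⟩
  have hpos := angular_eigenvalue_pos hm hn
  have hJ := one_add_mul_jacobiDeriv n (m - 1 / 2) (m + 1 / 2) x
  rw [show m + 1 / 2 - 1 = m - 1 / 2 by ring, show m - 1 / 2 + 1 = m + 1 / 2 by ring] at hJ
  have hd : deriv v x = -jacobiDeriv n (m - 1 / 2) (m + 1 / 2) x := by
    rw [funext hv]
    exact (hasDerivAt_jacobiP n (m - 1 / 2) (m + 1 / 2) x).fun_neg.deriv
  have h1 := hu x hx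
  rw [hd, hv] at h1
  -- The equation prescribed for u is the Jacobi relation with β = m + 1/2, whose factor n + β is
  -- |lam|.
  have h2 : ε * ((n : ℝ) + 1 / 2 + m) * u x =
      ((n : ℝ) + 1 / 2 + m) * jacobiP n (m + 1 / 2) (m - 1 / 2) x := by
    linear_combination hJ + h1
  have hε2 : ε * ε = 1 := by rcases hε with rfl | rfl <;> norm_num
  have hεn : |ε| = 1 := by rcases hε with rfl | rfl <;> norm_num
  refine ⟨by rw [abs_mul, hεn, one_mul, abs_of_pos hpos, h2], mul_left_cancel₀ hpos.ne' ?_⟩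
  linear_combination ε * h2 - ((n : ℝ) + 1 / 2 + m) * u x * hε2
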